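/- Let $X$ be a complex manifold of complex dimension $n$, and put $A=T^{1,0}X\oplus (T^{0,1}X)^*$, with dual $A^*=T^{0,1}X\oplus (T^{1,0}X)^*$. Let $[\cdot,\cdot]$ be the Schouten bracket on $\Gamma(\wedge^\bullet A)$, i.e. the Gerstenhaber bracket determined in holomorphic coordinates by $[\partial_{z_i},f]=\partial f/\partial z_i$, $[d\bar z_j,f]=0$ for smooth functions $f$, and $[\partial_{z_i},\partial_{z_j}]=[\partial_{z_i},d\bar z_j]=[d\bar z_i,d\bar z_j]=0$; all sections are smooth. Let $H\in\Gamma(\wedge^2A)$ be an extended Poisson structure, i.e. $\bar\partial H+\tfrac12[H,H]=0$. For $k\in\mathbb Z$, the Poisson cohomology $H^k(X,H)$ is the degree-$k$ cohomology of the complex $(\Gamma(\wedge^\bullet A),\ \bar\partial^H=\bar\partial+[H,\cdot\,])$. The Koszul–Brylinski homology $H_k(X,H)$ is the homology in degree $k$ of the complex whose degree-$k$ chains are $\bigoplus_{i-j=k-n}\Omega^{i,j}(X)$, with differential $\bar\partial+[\partial,\iota_H]$, $[\partial,\iota_H]=\partial\iota_H-\iota_H\partial$, which lowers the degree by one. Here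 $\iota_H\lambda=-H\cdot\lambda$, where $\wedge^\bullet A$ acts on forms through the Clifford action $(v+\xi)\cdot\lambda=\iota_v\lambda+\xi\wedge\lambda$ of $A$ (so for a bivector $\iota_H$ is the usual contraction). Let $A^*_H$ be the complex Lie algebroid on $A^*$ whose differential on $\Gamma(\wedge^\bullet A)$ is $\bar\partial^H$, with anchor $\rho_H$. It acts on the line bundle $Q=\wedge^{2n}A^*_H\otimes\wedge^{2n}T^*_{\mathbb C}X\cong K_X\otimes K_X$, $K_X=\wedge^n(T^{1,0}X)^*$, by $$\nabla^H_\alpha(\alpha_1\wedge\dots\wedge\alpha_{2n}\otimes\mu)=\sum_i\alpha_1\wedge\dots\wedge[\alpha,\alpha_i]_H\wedge\dots\wedge\alpha_{2n}\otimes\mu+\alpha_1\wedge\dots\wedge\alpha_{2n}\otimes L_{\rho_H(\alpha)}\mu ,$$ and hence on the square root $K_X=Q^{1/2}$. Call $(X,H)$ unimodular if $K_X=Q^{1/2}$ has a nowhere vanishing flat smooth section, i.e. if there is a nowhere vanishing smooth $(n,0)$-form $s$ on $X$ for which the section $s\otimes s$ of $Q$ satisfies $\nabla^H(s\otimes s)=0$.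 (Equivalently, $\bar\partial s+\partial\iota_H s=0$.) If $(X,H)$ is unimodular, then for every $k\in\mathbb Z$ there is an isomorphism of complex vector spaces $$H_k(X,H)\;\cong\;H^{2n-k}(X,H).$$ -/

import Mathlib

open scoped Manifold ContDiff Topology

noncomputable section

namespace ExtPoisson

/-! ### Fibres

A complex `n`-manifold is modelled on `Fin n → ℂ`.  Two rank `2n` bundles are used:
`A = T^{1,0} ⊕ (T^{0,1})^*`, with coordinate frame `∂/∂z_i, dz̄_j`, and
`T_ℂ^* = (T^{1,0})^* ⊕ (T^{0,1})^*`, with coordinate frame `dz_i, dz̄_j`.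
In a chart both have fibre `Fib n`: the first factor holds the coefficients of `∂/∂z_i`
(respectively `dz_i`), the second factor those of `dz̄_j`. -/

/-- Coordinate fibre of `A`, and also of the complexified cotangent bundle. -/
abbrev Fib (n : ℕ) : Type := (Fin n → ℂ) × (Fin n → ℂ)

/-- Coordinate fibre of `∧^• A`, and also of `∧^• T_ℂ^*`. -/
abbrev Ext (n : ℕ) : Type := ExteriorAlgebra ℂ (Fib n)

/-- The coordinate frame, indexed by `Fin (n + n)`. -/
def frame (n : ℕ) : Module.Basis (Fin (n + n)) ℂ (Fib n) :=
  ((Pi.basisFun ℂ (Fin n)).prod (Pi.basisFun ℂ (Fin n))).reindex finSumFinEquiv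

/-- The induced frame of the exterior algebra. -/
def extFrame (n : ℕ) : Module.Basis (Finset (Fin (n + n))) ℂ (Ext n) :=
  (frame n).ExteriorAlgebra

/-- The generator `∂/∂z_i` of `∧^• A`, respectively `dz_i` of `∧^• T_ℂ^*`. -/
def gen {n : ℕ} (i : Fin n) : Ext n := ExteriorAlgebra.ι ℂ ((Pi.single i 1, 0) : Fib n)

/-- The generator `dz̄_j`, in `∧^• A` and in `∧^• T_ℂ^*`. -/
def genBar {n : ℕ} (j : Fin n) : Ext n := ExteriorAlgebra.ι ℂ ((0, Pi.single j 1) : Fib n)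

/-- The functional on `Fib n` reading off the `i`-th entry of the first factor: the covector
`dz_i` on `A`, respectively the vector `∂/∂z_i` on `T_ℂ^*`. -/
def coord {n : ℕ} (i : Fin n) : Module.Dual ℂ (Fib n) :=
  (LinearMap.proj i).comp (LinearMap.fst ℂ (Fin n → ℂ) (Fin n → ℂ))

/-- Left interior product of an element of the exterior algebra by a functional. -/
def contrL {n : ℕ} (d : Module.Dual ℂ (Fib n)) : Ext n →ₗ[ℂ] Ext n :=
  CliffordAlgebra.contractLeft (Q := (0 : QuadraticForm ℂ (Fib n))) d

/-- Right interior product of an element of the exterior algebra by a functional. -/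
def contrR {n : ℕ} (d : Module.Dual ℂ (Fib n)) : Ext n →ₗ[ℂ] Ext n :=
  (CliffordAlgebra.contractRight (Q := (0 : QuadraticForm ℂ (Fib n)))).flip d

/-! ### Differential operators in a chart -/

/-- `∂f/∂z_i = ½ (∂f/∂x_i - √-1 ∂f/∂y_i)`. -/
def wirt {n : ℕ} (i : Fin n) (f : (Fin n → ℂ) → ℂ) (y : Fin n → ℂ) : ℂ :=
  (1 / 2 : ℂ) * (fderiv ℝ f y (Pi.single i 1) - Complex.I * fderiv ℝ f y (Pi.single i Complex.I))

/-- `∂f/∂z̄_i = ½ (∂f/∂x_i + √-1 ∂f/∂y_i)`. -/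
def wirtBar {n : ℕ} (i : Fin n) (f : (Fin n → ℂ) → ℂ) (y : Fin n → ℂ) : ℂ :=
  (1 / 2 : ℂ) * (fderiv ℝ f y (Pi.single i 1) + Complex.I * fderiv ℝ f y (Pi.single i Complex.I))

/-- Coefficient `S` of a function with values in the exterior algebra. -/
def coeff {n : ℕ} (S : Finset (Fin (n + n))) (u : (Fin n → ℂ) → Ext n) (y : Fin n → ℂ) : ℂ :=
  (extFrame n).repr (u y) S

/-- Coefficientwise `∂/∂z_i`. -/
def pd {n : ℕ} (i : Fin n) (u : (Fin n → ℂ) → Ext n) (y : Fin n → ℂ) : Ext n :=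
  ∑ S, wirt i (coeff S u) y • extFrame n S

/-- Coefficientwise `∂/∂z̄_i`. -/
def pdBar {n : ℕ} (i : Fin n) (u : (Fin n → ℂ) → Ext n) (y : Fin n → ℂ) : Ext n :=
  ∑ S, wirtBar i (coeff S u) y • extFrame n S

/-- `∂̄ u = Σ_j dz̄_j ∧ ∂u/∂z̄_j`, on sections of `∧^• A` and on differential forms. -/
def dbar {n : ℕ} (u : (Fin n → ℂ) → Ext n) (y : Fin n → ℂ) : Ext n :=
  ∑ j, genBar j * pdBar j u y

/-- `∂ λ = Σ_i dz_i ∧ ∂λ/∂z_i`, on differential forms. -/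
def del {n : ℕ} (l : (Fin n → ℂ) → Ext n) (y : Fin n → ℂ) : Ext n :=
  ∑ i, gen i * pd i l y

/-- The Schouten bracket of `∧^• A`: the unique Gerstenhaber bracket for which
`[∂/∂z_i, f] = ∂f/∂z_i`, `[dz̄_j, f] = 0`, and the generators `∂/∂z_i`, `dz̄_j` commute
with each other; that is
`[u, v] = Σ_i (u ⌊ dz_i) ∧ ∂v/∂z_i - ∂u/∂z_i ∧ (dz_i ⌋ v)`. -/
def schouten {n : ℕ} (u v : (Fin n → ℂ) → Ext n) (y : Fin n → ℂ) : Ext n :=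
  ∑ i, (contrR (coord i) (u y) * pd i v y - pd i u y * contrL (coord i) (v y))

/-- `∂̄^H u = ∂̄ u + [H, u]`. -/
def dbarTwist {n : ℕ} (H u : (Fin n → ℂ) → Ext n) (y : Fin n → ℂ) : Ext n :=
  dbar u y + schouten H u y

/-! ### Clifford action of `∧^• A` on forms -/

/-- A vector `v = Σ v_i ∂/∂z_i` as a functional on `T_ℂ^*`. -/
def vecPair {n : ℕ} : (Fin n → ℂ) →ₗ[ℂ] Module.Dual ℂ (Fib n) :=
  Fintype.linearCombination ℂ coord

/-- An element `v + ξ` of `A` acts on forms by `λ ↦ ι_v λ + ξ ∧ λ`. -/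
def cliffordGen {n : ℕ} : Fib n →ₗ[ℂ] Module.End ℂ (Ext n) :=
  ((CliffordAlgebra.contractLeft (Q := (0 : QuadraticForm ℂ (Fib n)))).comp vecPair).comp
      (LinearMap.fst ℂ (Fin n → ℂ) (Fin n → ℂ)) +
    ((LinearMap.mul ℂ (Ext n)).comp (ExteriorAlgebra.ι ℂ)).comp
      ((LinearMap.inr ℂ (Fin n → ℂ) (Fin n → ℂ)).comp
        (LinearMap.snd ℂ (Fin n → ℂ) (Fin n → ℂ)))

theorem vecPair_inr {n : ℕ} (v w : Fin n → ℂ) : vecPair v ((0, w) : Fib n) = 0 := by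
  simp [vecPair, Fintype.linearCombination_apply, coord]

theorem cliffordGen_apply {n : ℕ} (a : Fib n) (l : Ext n) :
    cliffordGen a l = contrL (vecPair a.1) l + ExteriorAlgebra.ι ℂ ((0, a.2) : Fib n) * l := rfl

theorem contrL_ι_mul {n : ℕ} (d : Module.Dual ℂ (Fib n)) (a : Fib n) (l : Ext n) :
    contrL d (ExteriorAlgebra.ι ℂ a * l) = d a • l - ExteriorAlgebra.ι ℂ a * contrL d l :=
  CliffordAlgebra.contractLeft_ι_mul (Q := (0 : QuadraticForm ℂ (Fib n))) (d := d) a l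

theorem contrL_contrL {n : ℕ} (d : Module.Dual ℂ (Fib n)) (l : Ext n) :
    contrL d (contrL d l) = 0 :=
  CliffordAlgebra.contractLeft_contractLeft (Q := (0 : QuadraticForm ℂ (Fib n))) (d := d) l

theorem cliffordGen_sq {n : ℕ} (a : Fib n) : cliffordGen a * cliffordGen a = 0 := by
  refine LinearMap.ext fun l => ?_
  simp only [Module.End.mul_apply, cliffordGen_apply, map_add, contrL_contrL, contrL_ι_mul,
    vecPair_inr, ← mul_assoc, ExteriorAlgebra.ι_sq_zero]
  simp

/-- The action `u · λ` of `u ∈ ∧^• A`, as an element of the Clifford algebra, on forms: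
`a₁ ∧ ⋯ ∧ a_k` acts by the composite of the actions of the `a_i`. -/
def clifford {n : ℕ} : Ext n →ₐ[ℂ] Module.End ℂ (Ext n) :=
  ExteriorAlgebra.lift ℂ ⟨cliffordGen, cliffordGen_sq⟩

/-- The inner product `ι_H λ = - H · λ`; for a bivector it is the usual contraction. -/
def interior {n : ℕ} (H l : Ext n) : Ext n := -(clifford H l)

/-- The Koszul–Brylinski operator `∂̄ + [∂, ι_H]`, with `[∂, ι_H] = ∂ ι_H - ι_H ∂`. -/
def kbOp {n : ℕ} (H l : (Fin n → ℂ) → Ext n) (y : Fin n → ℂ) : Ext n :=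
  dbar l y + (del (fun z => interior (H z) (l z)) y - interior (H y) (del l y))

/-! ### The Lie algebroid `A^*_H` in a chart

A local section of `A^*` is a function with values in the dual of `Fib n`.  The Lie algebroid
structure is the one whose differential on `Γ(∧^• A)` is `∂̄^H`. -/

/-- Anchor of `A^*_H` applied to a function: `ρ_H(α) f = ⟨∂̄^H f, α⟩`. -/
def anchor {n : ℕ} (H : (Fin n → ℂ) → Ext n) (α : (Fin n → ℂ) → Module.Dual ℂ (Fib n))
    (f : (Fin n → ℂ) → ℂ) (y : Fin n → ℂ) : ℂ :=
  ExteriorAlgebra.algebraMapInv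
    (contrL (α y) (dbarTwist H (fun z => algebraMap ℂ (Ext n) (f z)) y))

/-- The bracket of `A^*_H`, through its pairing with a constant `a ∈ Γ(A)`:
`⟨a, [α, β]_H⟩ = ρ_H(α)⟨a, β⟩ - ρ_H(β)⟨a, α⟩ - (∂̄^H a)(α, β)`. -/
def bracketPair {n : ℕ} (H : (Fin n → ℂ) → Ext n)
    (α β : (Fin n → ℂ) → Module.Dual ℂ (Fib n)) (a : Fib n) (y : Fin n → ℂ) : ℂ :=
  anchor H α (fun z => β z a) y - anchor H β (fun z => α z a) y -
    ExteriorAlgebra.algebraMapInv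
      (contrL (β y) (contrL (α y) (dbarTwist H (fun _ => ExteriorAlgebra.ι ℂ a) y)))

/-- Divergence of `ρ_H(α)`: the factor by which the Lie derivative along `ρ_H(α)` multiplies
the coordinate volume form `dz_1 ∧ ⋯ ∧ dz_n ∧ dz̄_1 ∧ ⋯ ∧ dz̄_n`. -/
def anchorDiv {n : ℕ} (H : (Fin n → ℂ) → Ext n)
    (α : (Fin n → ℂ) → Module.Dual ℂ (Fib n)) (y : Fin n → ℂ) : ℂ :=
  ∑ i, (wirt i (anchor H α (fun z => z i)) y +
    wirtBar i (anchor H α (fun z => star (z i))) y)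

/-- The representation `∇^H` of `A^*_H` on `Q = ∧^{2n} A^*_H ⊗ ∧^{2n} T_ℂ^*`, in the coordinate
frame
`(∂/∂z̄_1 ∧ ⋯ ∧ ∂/∂z̄_n ∧ dz_1 ∧ ⋯ ∧ dz_n) ⊗ (dz_1 ∧ ⋯ ∧ dz_n ∧ dz̄_1 ∧ ⋯ ∧ dz̄_n)`.
For a section with coefficient `h` the result has coefficient
`ρ_H(α) h + h (Σ_c ⟨e_c, [α, e^c]_H⟩ + div ρ_H(α))`: the sum over the frame `e_c` of `A`, with
dual frame `e^c`, comes from replacing one factor of the frame of `∧^{2n} A^*_H` by its bracket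
with `α`, the divergence from the Lie derivative of the volume form. -/
def elw {n : ℕ} (H : (Fin n → ℂ) → Ext n) (α : (Fin n → ℂ) → Module.Dual ℂ (Fib n))
    (h : (Fin n → ℂ) → ℂ) (y : Fin n → ℂ) : ℂ :=
  anchor H α h y +
    h y * ((∑ c, bracketPair H α (fun _ => (frame n).coord c) (frame n c) y) + anchorDiv H α y)

/-- The coordinate section `dz_1 ∧ ⋯ ∧ dz_n` of the canonical bundle. -/
def holVol (n : ℕ) : Ext n :=
  ExteriorAlgebra.ιMulti ℂ n (fun i : Fin n => ((Pi.single i 1, 0) : Fib n))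

/-! ### Degrees -/

/-- `∧^k A`, for an integer `k` (zero for negative `k`). -/
def polyDeg (n : ℕ) (k : ℤ) : Submodule ℂ (Ext n) :=
  ⨆ (j : ℕ) (_ : (j : ℤ) = k), ⋀[ℂ]^j (Fib n)

/-- `∧^i (T^{1,0})^* ⊗ ∧^j (T^{0,1})^*`, the forms of type `(i, j)`. -/
def formType (n i j : ℕ) : Submodule ℂ (Ext n) :=
  Submodule.span ℂ (Set.range gen) ^ i * Submodule.span ℂ (Set.range genBar) ^ j

/-- `⊕_{i - j = m} ∧^i (T^{1,0})^* ⊗ ∧^j (T^{0,1})^*`. -/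
def formDeg (n : ℕ) (m : ℤ) : Submodule ℂ (Ext n) :=
  ⨆ (i : ℕ) (j : ℕ) (_ : (i : ℤ) - j = m), formType n i j

/-! ### Linearity of the operators in a chart -/

/-- All coefficients of `u` are real differentiable at `y`. -/
def DiffAt {n : ℕ} (u : (Fin n → ℂ) → Ext n) (y : Fin n → ℂ) : Prop :=
  ∀ S, DifferentiableAt ℝ (coeff S u) y

theorem coeff_add {n : ℕ} (S : Finset (Fin (n + n))) (u v : (Fin n → ℂ) → Ext n) :
    coeff S (u + v) = coeff S u + coeff S v := by
  ext y; simp [coeff]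

theorem coeff_smul {n : ℕ} (S : Finset (Fin (n + n))) (c : ℂ) (u : (Fin n → ℂ) → Ext n) :
    coeff S (c • u) = c • coeff S u := by
  ext y; simp [coeff]

theorem pd_add {n : ℕ} (i : Fin n) {u v : (Fin n → ℂ) → Ext n} {y : Fin n → ℂ}
    (hu : DiffAt u y) (hv : DiffAt v y) : pd i (u + v) y = pd i u y + pd i v y := by
  simp only [pd, ← Finset.sum_add_distrib, ← add_smul]
  refine Finset.sum_congr rfl fun S _ => ?_
  rw [coeff_add]
  simp only [wirt]
  rw [fderiv_add (hu S) (hv S)]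
  simp only [_root_.add_apply]
  congr 1; ring

theorem pdBar_add {n : ℕ} (i : Fin n) {u v : (Fin n → ℂ) → Ext n} {y : Fin n → ℂ}
    (hu : DiffAt u y) (hv : DiffAt v y) : pdBar i (u + v) y = pdBar i u y + pdBar i v y := by
  simp only [pdBar, ← Finset.sum_add_distrib, ← add_smul]
  refine Finset.sum_congr rfl fun S _ => ?_
  rw [coeff_add]
  simp only [wirtBar]
  rw [fderiv_add (hu S) (hv S)]
  simp only [_root_.add_apply]
  congr 1; ring

theorem pd_smul {n : ℕ} (i : Fin n) (c : ℂ) {u : (Fin n → ℂ) → Ext n} {y : Fin n → ℂ}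
    (hu : DiffAt u y) : pd i (c • u) y = c • pd i u y := by
  simp only [pd, Finset.smul_sum, smul_smul]
  refine Finset.sum_congr rfl fun S _ => ?_
  rw [coeff_smul]
  simp only [wirt]
  rw [fderiv_const_smul (hu S)]
  simp only [_root_.smul_apply, smul_eq_mul]
  congr 1; ring

theorem pdBar_smul {n : ℕ} (i : Fin n) (c : ℂ) {u : (Fin n → ℂ) → Ext n} {y : Fin n → ℂ}
    (hu : DiffAt u y) : pdBar i (c • u) y = c • pdBar i u y := by
  simp only [pdBar, Finset.smul_sum, smul_smul]
  refine Finset.sum_congr rfl fun S _ => ?_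
  rw [coeff_smul]
  simp only [wirtBar]
  rw [fderiv_const_smul (hu S)]
  simp only [_root_.smul_apply, smul_eq_mul]
  congr 1; ring

theorem dbar_add {n : ℕ} {u v : (Fin n → ℂ) → Ext n} {y : Fin n → ℂ}
    (hu : DiffAt u y) (hv : DiffAt v y) : dbar (u + v) y = dbar u y + dbar v y := by
  simp only [dbar, pdBar_add _ hu hv, mul_add, Finset.sum_add_distrib]

theorem dbar_smul {n : ℕ} (c : ℂ) {u : (Fin n → ℂ) → Ext n} {y : Fin n → ℂ}
    (hu : DiffAt u y) : dbar (c • u) y = c • dbar u y := by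
  simp only [dbar, pdBar_smul _ c hu, mul_smul_comm, Finset.smul_sum]

theorem del_add {n : ℕ} {u v : (Fin n → ℂ) → Ext n} {y : Fin n → ℂ}
    (hu : DiffAt u y) (hv : DiffAt v y) : del (u + v) y = del u y + del v y := by
  simp only [del, pd_add _ hu hv, mul_add, Finset.sum_add_distrib]

theorem del_smul {n : ℕ} (c : ℂ) {u : (Fin n → ℂ) → Ext n} {y : Fin n → ℂ}
    (hu : DiffAt u y) : del (c • u) y = c • del u y := by
  simp only [del, pd_smul _ c hu, mul_smul_comm, Finset.smul_sum]

theorem dbarTwist_add {n : ℕ} (H : (Fin n → ℂ) → Ext n) {u v : (Fin n → ℂ) → Ext n}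
    {y : Fin n → ℂ} (hu : DiffAt u y) (hv : DiffAt v y) :
    dbarTwist H (u + v) y = dbarTwist H u y + dbarTwist H v y := by
  have hs : schouten H (u + v) y = schouten H u y + schouten H v y := by
    simp only [schouten, pd_add _ hu hv, Pi.add_apply, map_add, mul_add,
      ← Finset.sum_add_distrib]
    exact Finset.sum_congr rfl fun i _ => by abel
  rw [dbarTwist, dbar_add hu hv, hs]
  simp only [dbarTwist]; abel

theorem dbarTwist_smul {n : ℕ} (H : (Fin n → ℂ) → Ext n) (c : ℂ) {u : (Fin n → ℂ) → Ext n}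
    {y : Fin n → ℂ} (hu : DiffAt u y) :
    dbarTwist H (c • u) y = c • dbarTwist H u y := by
  simp only [dbarTwist, schouten, dbar_smul c hu, pd_smul _ c hu, Pi.smul_apply, map_smul,
    mul_smul_comm, smul_add, Finset.smul_sum, smul_sub]

theorem DiffAt.interior {n : ℕ} {H l : (Fin n → ℂ) → Ext n} {y : Fin n → ℂ}
    (hH : DiffAt H y) (hl : DiffAt l y) : DiffAt (fun z => interior (H z) (l z)) y := by
  intro S
  have h : coeff S (fun z => ExtPoisson.interior (H z) (l z)) = fun z => -∑ P, ∑ R,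
      coeff P H z * (coeff R l z *
        (extFrame n).repr (clifford (extFrame n P) (extFrame n R)) S) := by
    funext z
    have e1 : H z = ∑ P, coeff P H z • extFrame n P := ((extFrame n).sum_repr (H z)).symm
    have e2 : l z = ∑ R, coeff R l z • extFrame n R := ((extFrame n).sum_repr (l z)).symm
    conv_lhs => rw [coeff, ExtPoisson.interior, e1, e2]
    simp only [map_sum, map_smul, LinearMap.sum_apply, LinearMap.smul_apply, Finsupp.neg_apply,
      map_neg, Finsupp.smul_apply, Finsupp.coe_finsetSum, Finset.sum_apply, smul_eq_mul,
      Finset.mul_sum]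
    rw [Finset.sum_comm]
    simp only [mul_left_comm]
  rw [h]
  refine DifferentiableAt.neg (DifferentiableAt.fun_sum fun P _ => DifferentiableAt.fun_sum
    fun R _ => ?_)
  exact (hH P).mul ((hl R).mul_const _)

theorem kbOp_add {n : ℕ} {H u v : (Fin n → ℂ) → Ext n} {y : Fin n → ℂ}
    (hH : DiffAt H y) (hu : DiffAt u y) (hv : DiffAt v y) :
    kbOp H (u + v) y = kbOp H u y + kbOp H v y := by
  have e : (fun z => interior (H z) ((u + v) z)) =
      (fun z => interior (H z) (u z)) + fun z => interior (H z) (v z) := by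
    funext z; simp [interior, add_comm]
  rw [kbOp, e, dbar_add hu hv, del_add (hH.interior hu) (hH.interior hv), del_add hu hv]
  simp only [kbOp, interior, map_add]; abel

theorem kbOp_smul {n : ℕ} {H u : (Fin n → ℂ) → Ext n} (c : ℂ) {y : Fin n → ℂ}
    (hH : DiffAt H y) (hu : DiffAt u y) : kbOp H (c • u) y = c • kbOp H u y := by
  have e : (fun z => interior (H z) ((c • u) z)) = c • fun z => interior (H z) (u z) := by
    funext z; simp [interior]
  rw [kbOp, e, dbar_smul c hu, del_smul c (hH.interior hu), del_smul c hu]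
  simp only [kbOp, interior, map_smul, smul_add, smul_sub, smul_neg]

/-! ### Bundles and sections over a complex manifold

As for Mathlib's tangent bundle, the fibre of a bundle at `x` is the coordinate fibre in the
preferred chart at `x`, so that a (set-theoretic) section of `∧^• A` or of `∧^• T_ℂ^*` is a
function `X → Ext n`.  Its expression in the preferred chart at `p` is found by the change of
frame. -/

variable {n : ℕ} {X : Type*} [TopologicalSpace X] [ChartedSpace (Fin n → ℂ) X]
  [IsManifold 𝓘(ℂ, Fin n → ℂ) ω X]

/-- Complex Jacobian matrix at `x` of the coordinate change from the chart at `p` to the chart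
at `q`. -/
def jac (p q x : X) : Matrix (Fin n) (Fin n) ℂ :=
  LinearMap.toMatrix' (tangentCoordChange 𝓘(ℂ, Fin n → ℂ) p q x : (Fin n → ℂ) →ₗ[ℂ] (Fin n → ℂ))

/-- Change of frame of `A` at `x`, from the chart at `x` to the chart at `p`. -/
def polyChange (p x : X) : Fib n →ₗ[ℂ] Fib n :=
  (jac x p x).mulVecLin.prodMap ((jac p x x).map star).vecMulLinear

/-- Change of frame of `T_ℂ^*` at `x`, from the chart at `x` to the chart at `p`. -/
def formChange (p x : X) : Fib n →ₗ[ℂ] Fib n :=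
  (jac p x x).vecMulLinear.prodMap ((jac p x x).map star).vecMulLinear

/-- Expression of a section of `∧^• A` in the chart at `p` (meaningful on the chart's target). -/
def polyLoc (p : X) : (X → Ext n) →ₗ[ℂ] ((Fin n → ℂ) → Ext n) where
  toFun u y := ExteriorAlgebra.map (polyChange p ((chartAt (Fin n → ℂ) p).symm y))
    (u ((chartAt (Fin n → ℂ) p).symm y))
  map_add' u v := by funext y; simp
  map_smul' c u := by funext y; simp

/-- Expression of a differential form in the chart at `p` (meaningful on the chart's target). -/
def formLoc (p : X) : (X → Ext n) →ₗ[ℂ] ((Fin n → ℂ) → Ext n) where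
  toFun u y := ExteriorAlgebra.map (formChange p ((chartAt (Fin n → ℂ) p).symm y))
    (u ((chartAt (Fin n → ℂ) p).symm y))
  map_add' u v := by funext y; simp
  map_smul' c u := by funext y; simp

variable (n X) in
/-- `Γ(∧^• A)`: sections that are smooth (over the reals) in every chart. -/
def PolySections : Submodule ℂ (X → Ext n) where
  carrier := {u | ∀ p S, ContDiffOn ℝ ∞ (coeff S (polyLoc p u)) (chartAt (Fin n → ℂ) p).target}
  add_mem' hu hv p S := by
    rw [map_add, coeff_add]; exact (hu p S).add (hv p S)
  zero_mem' p S := by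
    have : coeff S (polyLoc p (0 : X → Ext n)) = fun _ => 0 := by
      funext y; simp [coeff]
    rw [this]; exact contDiffOn_const
  smul_mem' c u hu p S := by
    rw [map_smul, coeff_smul]; exact (hu p S).const_smul c

variable (n X) in
/-- `Ω^•(X)`: complex-valued differential forms that are smooth in every chart. -/
def FormSections : Submodule ℂ (X → Ext n) where
  carrier := {u | ∀ p S, ContDiffOn ℝ ∞ (coeff S (formLoc p u)) (chartAt (Fin n → ℂ) p).target}
  add_mem' hu hv p S := by
    rw [map_add, coeff_add]; exact (hu p S).add (hv p S)
  zero_mem' p S := by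
    have : coeff S (formLoc p (0 : X → Ext n)) = fun _ => 0 := by
      funext y; simp [coeff]
    rw [this]; exact contDiffOn_const
  smul_mem' c u hu p S := by
    rw [map_smul, coeff_smul]; exact (hu p S).const_smul c

theorem PolySections.diffAt {u : X → Ext n} (hu : u ∈ PolySections n X) (x : X) :
    DiffAt (polyLoc x u) (chartAt (Fin n → ℂ) x x) := fun S =>
  ((hu x S).contDiffAt ((chartAt (Fin n → ℂ) x).open_target.mem_nhds
    (mem_chart_target _ x))).differentiableAt (by simp)

theorem FormSections.diffAt {u : X → Ext n} (hu : u ∈ FormSections n X) (x : X) :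
    DiffAt (formLoc x u) (chartAt (Fin n → ℂ) x x) := fun S =>
  ((hu x S).contDiffAt ((chartAt (Fin n → ℂ) x).open_target.mem_nhds
    (mem_chart_target _ x))).differentiableAt (by simp)

variable (n X) in
/-- An extended Poisson structure: `H ∈ Γ(∧² A)` with `∂̄ H + ½ [H, H] = 0`. -/
structure ExtendedPoisson where
  /-- the underlying section -/
  sec : X → Ext n
  smooth : sec ∈ PolySections n X
  degree : ∀ x, sec x ∈ polyDeg n 2
  maurerCartan : ∀ x : X,
    dbar (polyLoc x sec) (chartAt (Fin n → ℂ) x x) +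
      (1 / 2 : ℂ) • schouten (polyLoc x sec) (polyLoc x sec) (chartAt (Fin n → ℂ) x x) = 0

/-- `∂̄^H = ∂̄ + [H, ·]` on `Γ(∧^• A)`, computed at `x` in the chart at `x`. -/
def poissonD (H : ExtendedPoisson n X) : PolySections n X →ₗ[ℂ] (X → Ext n) where
  toFun u x := dbarTwist (polyLoc x H.sec) (polyLoc x u.1) (chartAt (Fin n → ℂ) x x)
  map_add' u v := by
    funext x
    simp only [Submodule.coe_add, map_add, Pi.add_apply]
    exact dbarTwist_add _ (PolySections.diffAt u.2 x) (PolySections.diffAt v.2 x)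
  map_smul' c u := by
    funext x
    simp only [Submodule.coe_smul, map_smul, Pi.smul_apply, RingHom.id_apply]
    exact dbarTwist_smul _ c (PolySections.diffAt u.2 x)

/-- `∂̄ + [∂, ι_H]` on `Ω^•(X)`, computed at `x` in the chart at `x`. -/
def kbD (H : ExtendedPoisson n X) : FormSections n X →ₗ[ℂ] (X → Ext n) where
  toFun u x := kbOp (polyLoc x H.sec) (formLoc x u.1) (chartAt (Fin n → ℂ) x x)
  map_add' u v := by
    funext x
    simp only [Submodule.coe_add, map_add, Pi.add_apply]
    exact kbOp_add (PolySections.diffAt H.smooth x) (FormSections.diffAt u.2 x)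
      (FormSections.diffAt v.2 x)
  map_smul' c u := by
    funext x
    simp only [Submodule.coe_smul, map_smul, Pi.smul_apply, RingHom.id_apply]
    exact kbOp_smul c (PolySections.diffAt H.smooth x) (FormSections.diffAt u.2 x)

variable (n X) in
/-- `Γ(∧^k A)`. -/
def polyGraded (k : ℤ) : Submodule ℂ (PolySections n X) where
  carrier := {u | ∀ x, u.1 x ∈ polyDeg n k}
  add_mem' hu hv x := add_mem (hu x) (hv x)
  zero_mem' _ := zero_mem _
  smul_mem' c _ hu x := Submodule.smul_mem _ c (hu x)

variable (n X) in
/-- The chains of degree `k`, `⊕_{i - j = k - n} Ω^{i,j}(X)`. -/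
def formGraded (k : ℤ) : Submodule ℂ (FormSections n X) where
  carrier := {u | ∀ x, u.1 x ∈ formDeg n (k - n)}
  add_mem' hu hv x := add_mem (hu x) (hv x)
  zero_mem' _ := zero_mem _
  smul_mem' c _ hu x := Submodule.smul_mem _ c (hu x)

/-- Cocycles in `Γ(∧^k A)`. -/
def poissonZ (H : ExtendedPoisson n X) (k : ℤ) : Submodule ℂ (X → Ext n) :=
  (polyGraded n X k ⊓ LinearMap.ker (poissonD H)).map (PolySections n X).subtype

/-- Coboundaries of degree `k`: the `∂̄^H w` with `w ∈ Γ(∧^{k-1} A)`. -/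
def poissonB (H : ExtendedPoisson n X) (k : ℤ) : Submodule ℂ (X → Ext n) :=
  (polyGraded n X (k - 1)).map (poissonD H)

/-- The Poisson cohomology `H^k(X, H)`, cocycles modulo coboundaries. -/
abbrev PoissonCohomology (H : ExtendedPoisson n X) (k : ℤ) : Type _ :=
  poissonZ H k ⧸ (poissonB H k).submoduleOf (poissonZ H k)

/-- Cycles of degree `k`. -/
def kbZ (H : ExtendedPoisson n X) (k : ℤ) : Submodule ℂ (X → Ext n) :=
  (formGraded n X k ⊓ LinearMap.ker (kbD H)).map (FormSections n X).subtype

/-- Boundaries of degree `k`: the operator lowers the degree `i - j + n` by one. -/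
def kbB (H : ExtendedPoisson n X) (k : ℤ) : Submodule ℂ (X → Ext n) :=
  (formGraded n X (k + 1)).map (kbD H)

/-- The Koszul–Brylinski Poisson homology `H_k(X, H)`, cycles modulo boundaries. -/
abbrev KBHomology (H : ExtendedPoisson n X) (k : ℤ) : Type _ :=
  kbZ H k ⧸ (kbB H k).submoduleOf (kbZ H k)

/-- Unimodularity: there is a nowhere vanishing smooth section `s` of the canonical bundle
`K = ∧^n (T^{1,0})^*`, a square root of the Evens–Lu–Weinstein module
`Q = ∧^{2n} A^*_H ⊗ ∧^{2n} T_ℂ^*`, whose square `s ⊗ s` is a flat section of `Q`.  If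
`s = g dz_1 ∧ ⋯ ∧ dz_n` in a chart, then `s ⊗ s` has coefficient `g²` in the coordinate frame
of `Q`. -/
def ExtendedPoisson.IsUnimodular (H : ExtendedPoisson n X) : Prop :=
  ∃ s ∈ FormSections n X, (∀ x, s x ∈ formType n n 0) ∧ (∀ x, s x ≠ 0) ∧
    ∀ x : X, ∃ g : (Fin n → ℂ) → ℂ,
      (∀ y ∈ (chartAt (Fin n → ℂ) x).target, formLoc x s y = g y • holVol n) ∧
      ∀ α : Module.Dual ℂ (Fib n),
        elw (polyLoc x H.sec) (fun _ => α) (fun y => g y ^ 2) (chartAt (Fin n → ℂ) x x) = 0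

end ExtPoisson

end

namespace ExtPoisson

/-! ### Algebra of the Clifford action -/

section Algebra

variable {n : ℕ}

/-! Let `s` be the nowhere vanishing section given by unimodularity and let D = ∂̄ + [∂, ι_H]. The
isomorphism is induced by u ↦ u · s, the Clifford action on `s`.

Fibrewise this is an isomorphism: in a chart `s` is a nonzero multiple of vol = dz_1 ∧ ⋯ ∧ dz_n,
contractions strip off the dz_i, and the dz̄_j are wedged on (`volEquiv`). It carries ∧^k A to the
forms with i - j = n - k (`volEquiv_mem_formDeg_iff`), that is, to chains of degree 2n - k, and it
matches smooth sections with smooth sections (`clifford_mem_formSections_iff`).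

It intertwines the differentials because D is a derivation of the Clifford module over ∂̄^H
(`kbOp_clifford`): D(u · λ) = (∂̄^H u) · λ + (-1)^{|u|} u · Dλ. The source of this rule is the
relation between dz_i ∧ and the Clifford action (`gen_mul_clifford`), together with the fact that
bivectors are central in ∧A. With Ds = 0 only D(u · s) = (∂̄^H u) · s remains.

Flatness of s ⊗ s gives Ds = 0. If s = g vol, then Ds = w · vol for an explicit w in A
(`kbOp_holVol`), while the coefficient of ∇^H_α(s ⊗ s) is 2g⟨α, w⟩ (`elw_sq`). Since g ≠ 0 and α is
arbitrary, w = 0. -/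

theorem ext_induction {P : Ext n → Prop} (scalar : ∀ r : ℂ, P (algebraMap ℂ (Ext n) r))
    (add : ∀ x y, P x → P y → P (x + y))
    (ι_mul : ∀ (x : Ext n) (a : Fib n), P x → P (ExteriorAlgebra.ι ℂ a * x)) (x : Ext n) : P x :=
  CliffordAlgebra.left_induction (0 : QuadraticForm ℂ (Fib n)) scalar add ι_mul x

/-- The grade involution `u ↦ (-1)^{|u|} u`. -/
noncomputable def gradeInv : Ext n →ₐ[ℂ] Ext n :=
  CliffordAlgebra.involute (Q := (0 : QuadraticForm ℂ (Fib n)))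

theorem gradeInv_ι (a : Fib n) : gradeInv (ExteriorAlgebra.ι ℂ a) = -ExteriorAlgebra.ι ℂ a :=
  CliffordAlgebra.involute_ι (Q := (0 : QuadraticForm ℂ (Fib n))) a

theorem ι_mul_ι (a b : Fib n) :
    ExteriorAlgebra.ι ℂ a * ExteriorAlgebra.ι ℂ b =
      -(ExteriorAlgebra.ι ℂ b * ExteriorAlgebra.ι ℂ a) :=
  eq_neg_of_add_eq_zero_left (ExteriorAlgebra.ι_add_mul_swap a b)

theorem ι_mul (a : Fib n) (u : Ext n) :
    ExteriorAlgebra.ι ℂ a * u = gradeInv u * ExteriorAlgebra.ι ℂ a := by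
  induction u using ext_induction with
  | scalar r => simp [Algebra.commutes]
  | add x y hx hy => simp [mul_add, add_mul, hx, hy]
  | ι_mul x b hx =>
    rw [← mul_assoc, ι_mul_ι, neg_mul, mul_assoc, hx, map_mul, gradeInv_ι, neg_mul, neg_mul,
      mul_assoc]

theorem contrL_algebraMap (d : Module.Dual ℂ (Fib n)) (r : ℂ) :
    contrL d (algebraMap ℂ (Ext n) r) = 0 :=
  CliffordAlgebra.contractLeft_algebraMap (Q := (0 : QuadraticForm ℂ (Fib n))) (d := d) r

theorem contrL_one (d : Module.Dual ℂ (Fib n)) : contrL d (1 : Ext n) = 0 := by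
  simpa using contrL_algebraMap d (1 : ℂ)

theorem contrL_ι (d : Module.Dual ℂ (Fib n)) (a : Fib n) :
    contrL d (ExteriorAlgebra.ι ℂ a) = algebraMap ℂ (Ext n) (d a) :=
  CliffordAlgebra.contractLeft_ι (Q := (0 : QuadraticForm ℂ (Fib n))) (d := d) a

theorem contrL_comm (d d' : Module.Dual ℂ (Fib n)) (u : Ext n) :
    contrL d (contrL d' u) = -contrL d' (contrL d u) :=
  CliffordAlgebra.contractLeft_comm (Q := (0 : QuadraticForm ℂ (Fib n))) d d' u

theorem contrL_sum_smul {κ : Type*} (s : Finset κ) (c : κ → ℂ) (d : κ → Module.Dual ℂ (Fib n))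
    (u : Ext n) : contrL (∑ k ∈ s, c k • d k) u = ∑ k ∈ s, c k • contrL (d k) u := by
  simp [contrL, map_sum]

theorem contrL_map (B : Fib n →ₗ[ℂ] Fib n) (d : Module.Dual ℂ (Fib n)) (l : Ext n) :
    contrL d (ExteriorAlgebra.map B l) = ExteriorAlgebra.map B (contrL (d ∘ₗ B) l) := by
  induction l using ext_induction with
  | scalar r => simp [contrL_algebraMap]
  | add x y hx hy => simp [hx, hy]
  | ι_mul x a hx => simp [contrL_ι_mul, hx]

theorem clifford_ι (a : Fib n) (l : Ext n) :
    clifford (ExteriorAlgebra.ι ℂ a) l =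
      contrL (vecPair a.1) l + ExteriorAlgebra.ι ℂ ((0, a.2) : Fib n) * l := by
  rw [clifford, ExteriorAlgebra.lift_ι_apply, cliffordGen_apply]

theorem clifford_mul_apply (u v l : Ext n) : clifford (u * v) l = clifford u (clifford v l) := by
  rw [map_mul, Module.End.mul_apply]

theorem vecPair_single (i : Fin n) : vecPair (Pi.single i (1 : ℂ)) = coord i := by
  simp [vecPair, Fintype.linearCombination_apply_single]

theorem clifford_gen (i : Fin n) (l : Ext n) : clifford (gen i) l = contrL (coord i) l := by
  have : ((0, 0) : Fib n) = 0 := rfl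
  simp [gen, clifford_ι, vecPair_single, this]

theorem clifford_genBar (j : Fin n) (l : Ext n) : clifford (genBar j) l = genBar j * l := by
  simp only [genBar, clifford_ι, map_zero]
  simp [contrL]

theorem coord_apply (i : Fin n) (a : Fib n) : coord i a = a.1 i := rfl

theorem vecPair_apply (v : Fin n → ℂ) (a : Fib n) : vecPair v a = ∑ i, v i * a.1 i := by
  simp [vecPair, Fintype.linearCombination_apply, coord_apply]

/-- Wedging with `dz_i` commutes with the Clifford action up to sign and a contraction. -/
theorem gen_mul_clifford (i : Fin n) (u l : Ext n) :
    gen i * clifford u l = clifford (gradeInv u) (gen i * l) + clifford (contrL (coord i) u) l := by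
  induction u using ext_induction generalizing l with
  | scalar r =>
    simp [contrL_algebraMap, Module.algebraMap_end_apply]
  | add x y hx hy => simp only [map_add, LinearMap.add_apply, mul_add, hx, hy]; abel
  | ι_mul x a hx =>
    -- The degree one case is a Clifford relation: dz_i anticommutes with the dz̄ part of `a`, and
    -- with its vector part up to their pairing.
    have key : ∀ m : Ext n, gen i * clifford (ExteriorAlgebra.ι ℂ a) m =
        coord i a • m - clifford (ExteriorAlgebra.ι ℂ a) (gen i * m) := by
      intro m
      have h1 : vecPair a.1 ((Pi.single i 1, 0) : Fib n) = coord i a := by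
        simp [vecPair_apply, coord_apply, Pi.single_apply]
      rw [clifford_ι, clifford_ι, gen, contrL_ι_mul, h1, mul_add, ← mul_assoc, ← mul_assoc,
        ι_mul_ι, neg_mul]
      abel
    rw [clifford_mul_apply, key, hx, map_mul gradeInv, gradeInv_ι, clifford_mul_apply, contrL_ι_mul]
    simp only [map_add, map_sub, map_neg, map_smul, LinearMap.neg_apply, LinearMap.sub_apply,
      LinearMap.smul_apply, clifford_mul_apply]
    abel

theorem genBar_mul_clifford (j : Fin n) (u l : Ext n) :
    genBar j * clifford u l = clifford (gradeInv u) (genBar j * l) := by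
  rw [← clifford_genBar, ← clifford_genBar, ← clifford_mul_apply, ← clifford_mul_apply, genBar,
    ι_mul]

/-! ### Equivariance -/

/-- Used twice: with Jacobians, for independence of the chart, and with scalings, for comparing
degrees. -/
theorem clifford_map {A B : Fib n →ₗ[ℂ] Fib n}
    (h₁ : ∀ a b : Fib n, vecPair (A a).1 (B b) = vecPair a.1 b)
    (h₂ : ∀ a : Fib n, ((0, (A a).2) : Fib n) = B (0, a.2)) (u l : Ext n) :
    clifford (ExteriorAlgebra.map A u) (ExteriorAlgebra.map B l) =
      ExteriorAlgebra.map B (clifford u l) := by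
  induction u using ext_induction generalizing l with
  | scalar r => simp [Module.algebraMap_end_apply]
  | add x y hx hy => simp [hx, hy]
  | ι_mul x a hx =>
    have h₃ : vecPair (A a).1 ∘ₗ B = vecPair a.1 := LinearMap.ext fun b => h₁ a b
    rw [map_mul, clifford_mul_apply, hx, clifford_mul_apply, ExteriorAlgebra.map_apply_ι,
      clifford_ι, clifford_ι, contrL_map, h₂, h₃, map_add, map_mul, ExteriorAlgebra.map_apply_ι]

/-! ### The coordinate section of the canonical bundle -/

theorem gen_mul_holVol (i : Fin n) : gen i * holVol n = 0 := by
  have h := ExteriorAlgebra.ιMulti_succ_apply (R := ℂ)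
    (Matrix.vecCons ((Pi.single i 1, 0) : Fib n) fun k : Fin n => ((Pi.single k 1, 0) : Fib n))
  rw [Matrix.cons_val_zero, Matrix.tail_cons] at h
  rw [gen, holVol, ← h]
  exact AlternatingMap.map_eq_zero_of_eq _ _ (i := 0) (j := i.succ) rfl (Fin.succ_ne_zero i).symm

theorem holVol_eq_prod : holVol n = ((List.finRange n).map gen).prod := by
  rw [holVol, ExteriorAlgebra.ιMulti_apply, List.ofFn_eq_map]
  rfl

theorem contrL_coord_prod {L : List (Fin n)} {i : Fin n} (hi : i ∉ L) :
    contrL (coord i) (L.map gen).prod = 0 := by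
  induction L with
  | nil => simp [contrL_one]
  | cons j L ih =>
    rw [List.mem_cons, not_or] at hi
    rw [List.map_cons, List.prod_cons, gen, contrL_ι_mul, ih hi.2, coord_apply]
    simp [hi.1]

/-- The factors are contracted away from the left, one at a time; since they are distinct,
contracting by one of them does not touch the rest. -/
theorem exists_clifford_prod_eq_one {L : List (Fin n)} (hL : L.Nodup) :
    ∃ v, clifford v (L.map gen).prod = 1 := by
  induction L with
  | nil => exact ⟨1, by simp⟩
  | cons i L ih =>
    obtain ⟨hi, hL⟩ := List.nodup_cons.1 hL
    obtain ⟨v, hv⟩ := ih hL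
    refine ⟨v * gen i, ?_⟩
    rw [clifford_mul_apply, clifford_gen, List.map_cons, List.prod_cons, gen, contrL_ι_mul,
      contrL_coord_prod hi, coord_apply]
    simpa using hv

theorem fib_eq_sum (a : Fib n) :
    ExteriorAlgebra.ι ℂ a = ∑ i, a.1 i • gen i + ∑ j, a.2 j • genBar j := by
  simp only [gen, genBar, ← map_smul, ← map_sum, ← map_add]
  congr 1
  ext k <;> simp [Finset.sum_apply, Pi.single_apply, Prod.fst_sum, Prod.snd_sum]

/-- The orbit of vol contains 1 and is stable under left multiplication by every generator, so it is
the whole algebra. Stability under dz_i comes from `gen_mul_clifford`, whose first term dies because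
dz_i ∧ vol = 0. -/
theorem clifford_holVol_surjective (l : Ext n) : ∃ v, clifford v (holVol n) = l := by
  obtain ⟨v₁, hv₁⟩ := exists_clifford_prod_eq_one (List.nodup_finRange n)
  rw [← holVol_eq_prod] at hv₁
  let R : Submodule ℂ (Ext n) := LinearMap.range (clifford.toLinearMap.flip (holVol n))
  suffices h : l ∈ R from h
  induction l using ext_induction with
  | scalar r =>
    rw [Algebra.algebraMap_eq_smul_one]
    exact R.smul_mem r ⟨v₁, hv₁⟩
  | add x y hx hy => exact R.add_mem hx hy
  | ι_mul x a hx =>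
    obtain ⟨w, rfl⟩ := hx
    rw [fib_eq_sum, add_mul, Finset.sum_mul, Finset.sum_mul]
    refine R.add_mem (R.sum_mem fun i _ => ?_) (R.sum_mem fun j _ => ?_)
    · rw [smul_mul_assoc]
      refine R.smul_mem _ ⟨contrL (coord i) w, ?_⟩
      have := gen_mul_clifford i w (holVol n)
      rw [gen_mul_holVol, map_zero, zero_add] at this
      exact this.symm
    · rw [smul_mul_assoc]
      exact R.smul_mem _ ⟨genBar j * w, by
        simp [clifford_genBar]⟩

instance : FiniteDimensional ℂ (Ext n) := (extFrame n).finiteDimensional_of_finite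

variable (n) in
/-- The isomorphism `u ↦ u · (dz_1 ∧ ⋯ ∧ dz_n)`. -/
noncomputable def volEquiv : Ext n ≃ₗ[ℂ] Ext n :=
  LinearEquiv.ofBijective (clifford.toLinearMap.flip (holVol n))
    ⟨LinearMap.injective_iff_surjective.2 clifford_holVol_surjective, clifford_holVol_surjective⟩

theorem volEquiv_apply (u : Ext n) : volEquiv n u = clifford u (holVol n) := rfl

/-! ### Bivectors -/

theorem polyDeg_natCast (k : ℕ) : polyDeg n k = ⋀[ℂ]^k (Fib n) := by
  refine le_antisymm (iSup₂_le fun j hj => ?_) (le_iSup₂_of_le k rfl le_rfl)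
  rw [Nat.cast_inj.1 hj]

theorem polyDeg_two_induction {P : Ext n → Prop} (add : ∀ x y, P x → P y → P (x + y))
    (mul : ∀ a b : Fib n, P (ExteriorAlgebra.ι ℂ a * ExteriorAlgebra.ι ℂ b))
    {H : Ext n} (hH : H ∈ polyDeg n 2) : P H := by
  rw [show (2 : ℤ) = (2 : ℕ) from rfl, polyDeg_natCast] at hH
  rw [ExteriorAlgebra.exteriorPower, pow_two] at hH
  refine Submodule.mul_induction_on hH ?_ add
  rintro _ ⟨a, rfl⟩ _ ⟨b, rfl⟩
  exact mul a b

theorem gradeInv_of_polyDeg_two {H : Ext n} (hH : H ∈ polyDeg n 2) : gradeInv H = H := by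
  refine polyDeg_two_induction (P := fun H => gradeInv H = H)
    (fun x y hx hy => by rw [map_add, hx, hy]) (fun a b => ?_) hH
  rw [map_mul, gradeInv_ι, gradeInv_ι, neg_mul_neg]

theorem gradeInv_gradeInv (u : Ext n) : gradeInv (gradeInv u) = u :=
  CliffordAlgebra.involute_involute (Q := (0 : QuadraticForm ℂ (Fib n))) u

theorem commute_of_polyDeg_two {H : Ext n} (hH : H ∈ polyDeg n 2) (u : Ext n) :
    H * u = u * H := by
  refine polyDeg_two_induction (P := fun H => H * u = u * H)
    (fun x y hx hy => by rw [add_mul, mul_add, hx, hy]) (fun a b => ?_) hH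
  rw [mul_assoc, ι_mul b, ← mul_assoc, ι_mul a (gradeInv u), gradeInv_gradeInv, mul_assoc]

theorem contrL_of_polyDeg_two {H : Ext n} (hH : H ∈ polyDeg n 2) (d : Module.Dual ℂ (Fib n)) :
    ∃ a : Fib n, contrL d H = ExteriorAlgebra.ι ℂ a := by
  refine polyDeg_two_induction
    (P := fun H => ∃ a : Fib n, contrL d H = ExteriorAlgebra.ι ℂ a) ?_ (fun a b => ?_) hH
  · rintro x y ⟨a, ha⟩ ⟨b, hb⟩
    exact ⟨a + b, by rw [map_add, map_add, ha, hb]⟩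
  · refine ⟨d a • b - d b • a, ?_⟩
    rw [contrL_ι_mul, contrL_ι, map_sub, map_smul, map_smul, ← Algebra.commutes,
      ← Algebra.smul_def]

theorem contrR_ι_mul_ι (d : Module.Dual ℂ (Fib n)) (a b : Fib n) :
    contrR d (ExteriorAlgebra.ι ℂ a * ExteriorAlgebra.ι ℂ b) =
      -contrL d (ExteriorAlgebra.ι ℂ a * ExteriorAlgebra.ι ℂ b) := by
  have h : contrR d (ExteriorAlgebra.ι ℂ a * ExteriorAlgebra.ι ℂ b) =
      d b • ExteriorAlgebra.ι ℂ a - contrR d (ExteriorAlgebra.ι ℂ a) * ExteriorAlgebra.ι ℂ b :=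
    CliffordAlgebra.contractRight_mul_ι (Q := (0 : QuadraticForm ℂ (Fib n))) (d := d) b _
  have h' : contrR d (ExteriorAlgebra.ι ℂ a) = algebraMap ℂ (Ext n) (d a) :=
    CliffordAlgebra.contractRight_ι (Q := (0 : QuadraticForm ℂ (Fib n))) (d := d) a
  rw [h, h', contrL_ι_mul, contrL_ι, ← Algebra.commutes (d b), ← Algebra.smul_def,
    ← Algebra.smul_def]
  abel

/-- The Schouten bracket contracts H from the right, while commuting dz_i past the action of H
contracts it from the left; this sign reconciles the two. -/
theorem contrR_of_polyDeg_two {H : Ext n} (hH : H ∈ polyDeg n 2) (d : Module.Dual ℂ (Fib n)) :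
    contrR d H = -contrL d H := by
  refine polyDeg_two_induction (P := fun H => contrR d H = -contrL d H)
    (fun x y hx hy => ?_) (contrR_ι_mul_ι d) hH
  rw [map_add, map_add, hx, hy, neg_add]

theorem contrL_mul_of_polyDeg_two {H : Ext n} (hH : H ∈ polyDeg n 2)
    (d : Module.Dual ℂ (Fib n)) (u : Ext n) : contrL d H * u = gradeInv u * contrL d H := by
  obtain ⟨a, ha⟩ := contrL_of_polyDeg_two hH d
  rw [ha, ι_mul]

end Algebra

/-! ### Coefficientwise derivatives -/

section Calculus

variable {n : ℕ}

/-- The coefficientwise derivative of `u` obtained by applying `δ` to real differentials. -/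
noncomputable def pdWith (δ : ((Fin n → ℂ) →L[ℝ] ℂ) →ₗ[ℂ] ℂ) (u : (Fin n → ℂ) → Ext n)
    (y : Fin n → ℂ) : Ext n :=
  ∑ S, δ (fderiv ℝ (coeff S u) y) • extFrame n S

/-- The functional on real differentials giving `∂/∂z_i` for `c = -√-1` and `∂/∂z̄_i` for
`c = √-1`. -/
noncomputable def wirtFun (i : Fin n) (c : ℂ) : ((Fin n → ℂ) →L[ℝ] ℂ) →ₗ[ℂ] ℂ where
  toFun φ := (1 / 2 : ℂ) * (φ (Pi.single i 1) + c * φ (Pi.single i Complex.I))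
  map_add' φ ψ := by simp only [_root_.add_apply]; ring
  map_smul' a φ := by simp only [_root_.smul_apply, smul_eq_mul, RingHom.id_apply]; ring

theorem wirt_eq (i : Fin n) (f : (Fin n → ℂ) → ℂ) (y : Fin n → ℂ) :
    wirt i f y = wirtFun i (-Complex.I) (fderiv ℝ f y) := by
  simp only [wirt, wirtFun, LinearMap.coe_mk, AddHom.coe_mk]; ring

theorem wirtBar_eq (i : Fin n) (f : (Fin n → ℂ) → ℂ) (y : Fin n → ℂ) :
    wirtBar i f y = wirtFun i Complex.I (fderiv ℝ f y) := rfl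

theorem pd_eq (i : Fin n) (u : (Fin n → ℂ) → Ext n) (y : Fin n → ℂ) :
    pd i u y = pdWith (wirtFun i (-Complex.I)) u y := by
  simp only [pd, pdWith, wirt_eq]

theorem pdBar_eq (i : Fin n) (u : (Fin n → ℂ) → Ext n) (y : Fin n → ℂ) :
    pdBar i u y = pdWith (wirtFun i Complex.I) u y := rfl

theorem sum_coeff (u : (Fin n → ℂ) → Ext n) (z : Fin n → ℂ) :
    ∑ S, coeff S u z • extFrame n S = u z := (extFrame n).sum_repr (u z)

theorem functional_eq_sum (φ : Ext n →ₗ[ℂ] ℂ) (u : (Fin n → ℂ) → Ext n) :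
    (fun z => φ (u z)) = fun z => ∑ S, coeff S u z * φ (extFrame n S) := by
  funext z
  conv_lhs => rw [← sum_coeff u z]
  simp

theorem DiffAt.functional {u : (Fin n → ℂ) → Ext n} {y : Fin n → ℂ} (hu : DiffAt u y)
    (φ : Ext n →ₗ[ℂ] ℂ) : DifferentiableAt ℝ (fun z => φ (u z)) y := by
  rw [functional_eq_sum]
  exact DifferentiableAt.fun_sum fun S _ => (hu S).mul_const _

/-- Characterizes the coefficientwise derivative without the frame; compatibility with linear maps
and the Leibniz rule are tested on functionals through it. -/
theorem functional_pdWith (δ : ((Fin n → ℂ) →L[ℝ] ℂ) →ₗ[ℂ] ℂ) (φ : Ext n →ₗ[ℂ] ℂ)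
    {u : (Fin n → ℂ) → Ext n} {y : Fin n → ℂ} (hu : DiffAt u y) :
    φ (pdWith δ u y) = δ (fderiv ℝ (fun z => φ (u z)) y) := by
  rw [functional_eq_sum, fderiv_fun_sum fun S _ => (hu S).mul_const _]
  simp only [pdWith, map_sum, map_smul, smul_eq_mul]
  refine Finset.sum_congr rfl fun S _ => ?_
  rw [fderiv_mul_const (hu S), map_smul, smul_eq_mul, mul_comm]

theorem coeff_functional (S : Finset (Fin (n + n))) (u : (Fin n → ℂ) → Ext n) :
    coeff S u = fun z => (extFrame n).coord S (u z) := rfl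

theorem ext_coord {x y : Ext n} (h : ∀ S, (extFrame n).coord S x = (extFrame n).coord S y) :
    x = y :=
  (extFrame n).repr.injective (Finsupp.ext h)

theorem coord_pdWith (δ : ((Fin n → ℂ) →L[ℝ] ℂ) →ₗ[ℂ] ℂ) (u : (Fin n → ℂ) → Ext n)
    (y : Fin n → ℂ) (S : Finset (Fin (n + n))) :
    (extFrame n).coord S (pdWith δ u y) = δ (fderiv ℝ (coeff S u) y) := by
  simp [pdWith, Finsupp.single_apply]

theorem DiffAt.linear {u : (Fin n → ℂ) → Ext n} {y : Fin n → ℂ} (hu : DiffAt u y)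
    (L : Ext n →ₗ[ℂ] Ext n) : DiffAt (fun z => L (u z)) y := fun S =>
  hu.functional ((extFrame n).coord S ∘ₗ L)

theorem pdWith_linear (δ : ((Fin n → ℂ) →L[ℝ] ℂ) →ₗ[ℂ] ℂ) (L : Ext n →ₗ[ℂ] Ext n)
    {u : (Fin n → ℂ) → Ext n} {y : Fin n → ℂ} (hu : DiffAt u y) :
    pdWith δ (fun z => L (u z)) y = L (pdWith δ u y) := by
  refine ext_coord fun S => ?_
  rw [coord_pdWith]
  exact (functional_pdWith δ ((extFrame n).coord S ∘ₗ L) hu).symm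

theorem pdWith_congr (δ : ((Fin n → ℂ) →L[ℝ] ℂ) →ₗ[ℂ] ℂ) {u v : (Fin n → ℂ) → Ext n}
    {y : Fin n → ℂ} (h : u =ᶠ[𝓝 y] v) : pdWith δ u y = pdWith δ v y := by
  refine ext_coord fun S => ?_
  rw [coord_pdWith, coord_pdWith]
  have : coeff S u =ᶠ[𝓝 y] coeff S v := h.mono fun z hz => by simp only [coeff, hz]
  rw [this.fderiv_eq]

theorem bilin_functional_eq_sum (φ : Ext n →ₗ[ℂ] ℂ) (B : Ext n →ₗ[ℂ] Ext n →ₗ[ℂ] Ext n)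
    (u v : (Fin n → ℂ) → Ext n) :
    (fun z => φ (B (u z) (v z))) =
      fun z => ∑ S, coeff S u z * φ (B (extFrame n S) (v z)) := by
  funext z
  conv_lhs => rw [← sum_coeff u z]
  simp

theorem DiffAt.bilin {u v : (Fin n → ℂ) → Ext n} {y : Fin n → ℂ} (hu : DiffAt u y)
    (hv : DiffAt v y) (B : Ext n →ₗ[ℂ] Ext n →ₗ[ℂ] Ext n) :
    DiffAt (fun z => B (u z) (v z)) y := fun S => by
  rw [coeff_functional, bilin_functional_eq_sum]
  exact DifferentiableAt.fun_sum fun P _ =>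
    (hu P).mul (hv.functional ((extFrame n).coord S ∘ₗ B (extFrame n P)))

/-- Leibniz rule. -/
theorem pdWith_bilin (δ : ((Fin n → ℂ) →L[ℝ] ℂ) →ₗ[ℂ] ℂ)
    (B : Ext n →ₗ[ℂ] Ext n →ₗ[ℂ] Ext n) {u v : (Fin n → ℂ) → Ext n} {y : Fin n → ℂ}
    (hu : DiffAt u y) (hv : DiffAt v y) :
    pdWith δ (fun z => B (u z) (v z)) y = B (pdWith δ u y) (v y) + B (u y) (pdWith δ v y) := by
  refine ext_coord fun S => ?_
  have hP (P) : DifferentiableAt ℝ (fun z => (extFrame n).coord S (B (extFrame n P) (v z))) y :=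
    hv.functional ((extFrame n).coord S ∘ₗ B (extFrame n P))
  rw [coord_pdWith, coeff_functional, bilin_functional_eq_sum,
    fderiv_fun_sum fun P _ => (hu P).fun_mul (hP P)]
  have e₂ : B (u y) (pdWith δ v y) = ∑ P, coeff P u y • B (extFrame n P) (pdWith δ v y) := by
    conv_lhs => rw [← sum_coeff u y]
    simp
  rw [e₂, pdWith]
  simp only [map_sum, map_add, map_smul, LinearMap.sum_apply, LinearMap.smul_apply,
    ← Finset.sum_add_distrib, smul_eq_mul]
  refine Finset.sum_congr rfl fun P _ => ?_
  have e := functional_pdWith δ ((extFrame n).coord S ∘ₗ B (extFrame n P)) hv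
  simp only [LinearMap.comp_apply] at e
  rw [e, fderiv_fun_mul (hu P) (hP P), map_add, map_smul, map_smul, smul_eq_mul, smul_eq_mul]
  ring

theorem DiffAt.smul_const {f : (Fin n → ℂ) → ℂ} {y : Fin n → ℂ} (hf : DifferentiableAt ℝ f y)
    (x : Ext n) : DiffAt (fun z => f z • x) y := fun S => by
  have : coeff S (fun z => f z • x) = fun z => f z * (extFrame n).coord S x := by
    funext z; simp [coeff]
  rw [this]
  exact hf.mul_const _

theorem pdWith_smul_const (δ : ((Fin n → ℂ) →L[ℝ] ℂ) →ₗ[ℂ] ℂ) {f : (Fin n → ℂ) → ℂ}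
    {y : Fin n → ℂ} (hf : DifferentiableAt ℝ f y) (x : Ext n) :
    pdWith δ (fun z => f z • x) y = δ (fderiv ℝ f y) • x := by
  refine ext_coord fun S => ?_
  have : coeff S (fun z => f z • x) = fun z => f z * (extFrame n).coord S x := by
    funext z; simp [coeff]
  rw [coord_pdWith, this, fderiv_mul_const hf, map_smul, map_smul, smul_eq_mul, smul_eq_mul,
    mul_comm]

theorem pdWith_const (δ : ((Fin n → ℂ) →L[ℝ] ℂ) →ₗ[ℂ] ℂ) (x : Ext n) (y : Fin n → ℂ) :
    pdWith δ (fun _ => x) y = 0 := by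
  refine ext_coord fun S => ?_
  have : coeff S (fun _ => x) = fun _ : Fin n → ℂ => (extFrame n).coord S x := rfl
  rw [coord_pdWith, this, fderiv_const_apply, map_zero, map_zero]

/-- Coefficientwise derivatives of a function with values in a subspace stay in it. -/
theorem pdWith_mem (δ : ((Fin n → ℂ) →L[ℝ] ℂ) →ₗ[ℂ] ℂ) {W : Submodule ℂ (Ext n)}
    {u : (Fin n → ℂ) → Ext n} {y : Fin n → ℂ} (hu : DiffAt u y) (h : ∀ z, u z ∈ W) :
    pdWith δ u y ∈ W := by
  -- The projection onto a complement `V` along `W` kills `u`, hence also its derivative, and the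
  -- kernel of that projection is `W`.
  obtain ⟨V, hV⟩ := W.exists_isCompl
  have e := pdWith_linear δ (V.subtype ∘ₗ V.projectionOnto W hV.symm) hu
  have h0 : (fun z => (V.subtype ∘ₗ V.projectionOnto W hV.symm) (u z)) = fun _ => 0 := by
    funext z
    simp [h z]
  rw [h0, pdWith_const] at e
  have e' := e.symm
  simpa [Submodule.projectionOnto_apply_eq_zero_iff] using e'

/-! ### The Koszul–Brylinski operator is a module derivation -/

theorem DiffAt.clifford {u l : (Fin n → ℂ) → Ext n} {y : Fin n → ℂ} (hu : DiffAt u y)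
    (hl : DiffAt l y) : DiffAt (fun z => ExtPoisson.clifford (u z) (l z)) y :=
  hu.bilin hl ExtPoisson.clifford.toLinearMap

theorem pdWith_clifford (δ : ((Fin n → ℂ) →L[ℝ] ℂ) →ₗ[ℂ] ℂ) {u l : (Fin n → ℂ) → Ext n}
    {y : Fin n → ℂ} (hu : DiffAt u y) (hl : DiffAt l y) :
    pdWith δ (fun z => clifford (u z) (l z)) y =
      clifford (pdWith δ u y) (l y) + clifford (u y) (pdWith δ l y) :=
  pdWith_bilin δ clifford.toLinearMap hu hl

theorem pdWith_neg (δ : ((Fin n → ℂ) →L[ℝ] ℂ) →ₗ[ℂ] ℂ) {u : (Fin n → ℂ) → Ext n}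
    {y : Fin n → ℂ} (hu : DiffAt u y) : pdWith δ (fun z => -u z) y = -pdWith δ u y :=
  pdWith_linear δ (-LinearMap.id) hu

/-- Wedging with dz̄_j is itself the Clifford action of dz̄_j, so it passes `u` with a sign and no
contraction term. -/
theorem dbar_clifford {u l : (Fin n → ℂ) → Ext n} {y : Fin n → ℂ} (hu : DiffAt u y)
    (hl : DiffAt l y) :
    dbar (fun z => clifford (u z) (l z)) y =
      clifford (dbar u y) (l y) + clifford (gradeInv (u y)) (dbar l y) := by
  simp only [dbar, pdBar_eq, pdWith_clifford _ hu hl, mul_add, Finset.sum_add_distrib,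
    genBar_mul_clifford _ (u y)]
  simp only [map_sum, LinearMap.sum_apply, clifford_mul_apply, clifford_genBar]

/-- In terms of first derivatives, `[∂, ι_H] λ = -Σ_i (dz_i ∧ (∂_i H · λ) + (dz_i ⌋ H) · ∂_i λ)`. -/
theorem kbOp_eq {H l : (Fin n → ℂ) → Ext n} {y : Fin n → ℂ} (hH : DiffAt H y)
    (hl : DiffAt l y) (hdeg : ∀ z, H z ∈ polyDeg n 2) :
    kbOp H l y = dbar l y - ∑ i, (gen i * clifford (pd i H y) (l y) +
      clifford (contrL (coord i) (H y)) (pd i l y)) := by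
  simp only [kbOp, interior, del, pd_eq, pdWith_neg _ (hH.clifford hl),
    pdWith_clifford _ hH hl, sub_neg_eq_add]
  rw [sub_eq_add_neg, map_sum, ← Finset.sum_add_distrib, ← Finset.sum_neg_distrib]
  congr 1
  refine Finset.sum_congr rfl fun i _ => ?_
  rw [mul_neg, mul_add, gen_mul_clifford i (H y), gradeInv_of_polyDeg_two (hdeg y)]
  abel

theorem pd_mem_polyDeg {H : (Fin n → ℂ) → Ext n} {y : Fin n → ℂ} (hH : DiffAt H y)
    (hdeg : ∀ z, H z ∈ polyDeg n 2) (i : Fin n) : pd i H y ∈ polyDeg n 2 := by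
  rw [pd_eq]; exact pdWith_mem _ hH hdeg

/-- The two halves of the Schouten bracket have separate origins: ∂_iH ∧ (dz_i ⌋ u) appears when
dz_i is moved past `u`, and (H ⌊ dz_i) ∧ ∂_iu when ∂_i falls on `u`. -/
theorem kbOp_clifford {H u l : (Fin n → ℂ) → Ext n} {y : Fin n → ℂ} (hH : DiffAt H y)
    (hu : DiffAt u y) (hl : DiffAt l y) (hdeg : ∀ z, H z ∈ polyDeg n 2) :
    kbOp H (fun z => clifford (u z) (l z)) y =
      clifford (dbarTwist H u y) (l y) + clifford (gradeInv (u y)) (kbOp H l y) := by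
  rw [kbOp_eq hH (hu.clifford hl) hdeg, kbOp_eq hH hl hdeg, dbarTwist, dbar_clifford hu hl]
  have key : ∀ i, gen i * clifford (pd i H y) (clifford (u y) (l y)) +
      clifford (contrL (coord i) (H y)) (pd i (fun z => clifford (u z) (l z)) y) =
      clifford (gradeInv (u y)) (gen i * clifford (pd i H y) (l y) +
        clifford (contrL (coord i) (H y)) (pd i l y)) -
      clifford (contrR (coord i) (H y) * pd i u y -
        pd i H y * contrL (coord i) (u y)) (l y) := by
    intro i
    have hi := pd_mem_polyDeg hH hdeg i
    -- ∂_iH is a bivector, hence central, so `u` can be brought in front before dz_i is moved past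
    -- it; afterwards ∂_iH is commuted back. The contraction dz_i ⌋ H has degree one, so it passes
    -- `u` through the grade involution.
    rw [← clifford_mul_apply, commute_of_polyDeg_two hi, clifford_mul_apply, gen_mul_clifford,
      contrR_of_polyDeg_two (hdeg y), commute_of_polyDeg_two hi,
      pd_eq i (fun z => clifford (u z) (l z)),
      pdWith_clifford _ hu hl, ← pd_eq, ← pd_eq, map_add, map_add,
      ← clifford_mul_apply _ _ (pd i l y), contrL_mul_of_polyDeg_two (hdeg y) _ (u y)]
    simp only [map_sub, map_neg, neg_mul, LinearMap.sub_apply, LinearMap.neg_apply,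
      clifford_mul_apply]
    abel
  simp only [key, Finset.sum_sub_distrib, schouten, map_add, map_sub, map_sum,
    LinearMap.add_apply, LinearMap.sub_apply, LinearMap.sum_apply]
  abel

end Calculus

/-! ### Flatness of `s ⊗ s` means that `s` is closed -/

section Flatness

variable {n : ℕ}

/-- The pairing of the degree one part with a covector. -/
noncomputable def pairOne (α : Module.Dual ℂ (Fib n)) : Ext n →ₗ[ℂ] ℂ :=
  (ExteriorAlgebra.algebraMapInv (R := ℂ) (M := Fib n)).toLinearMap ∘ₗ contrL α

theorem pairOne_apply (α : Module.Dual ℂ (Fib n)) (u : Ext n) :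
    ExteriorAlgebra.algebraMapInv (contrL α u) = pairOne α u := rfl

theorem pairOne_ι (α : Module.Dual ℂ (Fib n)) (a : Fib n) :
    pairOne α (ExteriorAlgebra.ι ℂ a) = α a := by
  rw [← pairOne_apply, contrL_ι, ExteriorAlgebra.algebraMap_leftInverse]

theorem wirt_coord (i j : Fin n) (y : Fin n → ℂ) :
    wirt j (fun z => z i) y = if j = i then 1 else 0 := by
  have : fderiv ℝ (fun z : Fin n → ℂ => z i) y = ContinuousLinearMap.proj i :=
    (ContinuousLinearMap.proj (R := ℝ) (φ := fun _ : Fin n => ℂ) i).fderiv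
  rw [wirt, this]
  rcases eq_or_ne j i with rfl | h
  · simp; norm_num
  · simp [h, h.symm]

theorem wirtBar_coord (i j : Fin n) (y : Fin n → ℂ) : wirtBar j (fun z => z i) y = 0 := by
  have : fderiv ℝ (fun z : Fin n → ℂ => z i) y = ContinuousLinearMap.proj i :=
    (ContinuousLinearMap.proj (R := ℝ) (φ := fun _ : Fin n => ℂ) i).fderiv
  rw [wirtBar, this]
  rcases eq_or_ne j i with rfl | h
  · simp
  · simp [h.symm]

theorem fderiv_star_coord (i : Fin n) (y : Fin n → ℂ) :
    fderiv ℝ (fun z : Fin n → ℂ => star (z i)) y =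
      (Complex.conjCLE : ℂ →L[ℝ] ℂ).comp (ContinuousLinearMap.proj i) :=
  ((Complex.conjCLE : ℂ →L[ℝ] ℂ).comp
    (ContinuousLinearMap.proj (R := ℝ) (φ := fun _ : Fin n => ℂ) i)).fderiv

theorem wirt_star_coord (i j : Fin n) (y : Fin n → ℂ) :
    wirt j (fun z => star (z i)) y = 0 := by
  rw [wirt, fderiv_star_coord]
  rcases eq_or_ne j i with rfl | h
  · simp
  · simp [h.symm]

theorem wirtBar_star_coord (i j : Fin n) (y : Fin n → ℂ) :
    wirtBar j (fun z => star (z i)) y = if j = i then 1 else 0 := by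
  rw [wirtBar, fderiv_star_coord]
  rcases eq_or_ne j i with rfl | h
  · simp; norm_num
  · simp [h, h.symm]

theorem anchor_eq (H : (Fin n → ℂ) → Ext n) (α : (Fin n → ℂ) → Module.Dual ℂ (Fib n))
    {f : (Fin n → ℂ) → ℂ} {y : Fin n → ℂ} (hf : DifferentiableAt ℝ f y) :
    anchor H α f y = ∑ j, wirtBar j f y * pairOne (α y) (genBar j) +
      ∑ i, wirt i f y * pairOne (α y) (contrR (coord i) (H y)) := by
  simp only [anchor, pairOne_apply, dbarTwist, dbar, schouten, pd_eq, pdBar_eq,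
    Algebra.algebraMap_eq_smul_one, pdWith_smul_const _ hf, ← wirt_eq, ← wirtBar_eq, map_smul,
    contrL_one, smul_zero, mul_zero, sub_zero, mul_smul_comm, mul_one, map_add, map_sum,
    smul_eq_mul]

theorem anchor_const (H : (Fin n → ℂ) → Ext n) (α : (Fin n → ℂ) → Module.Dual ℂ (Fib n))
    (c : ℂ) (y : Fin n → ℂ) : anchor H α (fun _ => c) y = 0 := by
  rw [anchor_eq H α (differentiableAt_const c)]
  simp [wirt, wirtBar]

/-- The anchor sends z_i to ⟨α, H ⌊ dz_i⟩ and z̄_i to a constant, so only the holomorphic half of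
the divergence survives. -/
theorem anchorDiv_const {H : (Fin n → ℂ) → Ext n} {y : Fin n → ℂ} (hH : DiffAt H y)
    (α : Module.Dual ℂ (Fib n)) :
    anchorDiv H (fun _ => α) y = ∑ i, pairOne α (contrR (coord i) (pd i H y)) := by
  have e₁ (i : Fin n) : anchor H (fun _ => α) (fun z => z i) =
      fun z => (pairOne α ∘ₗ contrR (coord i)) (H z) := by
    funext z
    rw [anchor_eq H _ (by fun_prop)]
    simp [wirt_coord, wirtBar_coord]
  have e₂ (i : Fin n) : anchor H (fun _ => α) (fun z => star (z i)) =
      fun _ => pairOne α (genBar i) := by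
    funext z
    have hd : DifferentiableAt ℝ (fun z : Fin n → ℂ => star (z i)) z :=
      ((Complex.conjCLE : ℂ →L[ℝ] ℂ).comp
        (ContinuousLinearMap.proj (R := ℝ) (φ := fun _ : Fin n => ℂ) i)).differentiableAt
    rw [anchor_eq H _ hd]
    simp only [wirt_star_coord, wirtBar_star_coord]
    simp
  refine Finset.sum_congr rfl fun i _ => ?_
  rw [e₁, e₂, wirt_eq, ← functional_pdWith _ _ hH, ← pd_eq]
  simp [wirtBar]

/-- With constant `α`, `β` and `a` both anchor terms and ∂̄a vanish; what is left is the part of [H,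
a] that differentiates H. -/
theorem bracketPair_const (H : (Fin n → ℂ) → Ext n) (α β : Module.Dual ℂ (Fib n)) (a : Fib n)
    (y : Fin n → ℂ) :
    bracketPair H (fun _ => α) (fun _ => β) a y =
      ∑ i, coord i a * pairOne β (contrL α (pd i H y)) := by
  rw [bracketPair, anchor_const, anchor_const, pairOne_apply, dbarTwist]
  have hpd (i : Fin n) : pd i (fun _ => ExteriorAlgebra.ι ℂ a) y = 0 := by
    rw [pd_eq, pdWith_const]
  simp only [dbar, schouten, hpd, pdBar_eq, pdWith_const, mul_zero,
    Finset.sum_const_zero, contrL_ι, zero_sub, zero_add]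
  simp only [← Algebra.commutes, ← Algebra.smul_def, map_sum, map_neg, map_smul, smul_eq_mul,
    Finset.sum_neg_distrib, neg_zero, sub_neg_eq_add, zero_add]

/-- The trace of the bracket equals the divergence of the anchor (`anchorDiv_const`). This
coincidence doubles the zeroth order term of ∇^H and makes Q behave as a square. -/
theorem sum_bracketPair_frame {H : (Fin n → ℂ) → Ext n} {y : Fin n → ℂ} (hH : DiffAt H y)
    (hdeg : ∀ z, H z ∈ polyDeg n 2) (α : Module.Dual ℂ (Fib n)) :
    ∑ c, bracketPair H (fun _ => α) (fun _ => (frame n).coord c) (frame n c) y =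
      ∑ i, pairOne α (contrR (coord i) (pd i H y)) := by
  simp only [bracketPair_const]
  rw [Finset.sum_comm]
  refine Finset.sum_congr rfl fun i _ => ?_
  -- Summing over dual frames, Σ_c ⟨dz_i, e_c⟩ e^c = dz_i, collapses the trace to one contraction.
  have h := contrL_sum_smul Finset.univ (fun c => coord i (frame n c))
    (fun c => (frame n).coord c) (contrL α (pd i H y))
  rw [Module.Basis.sum_dual_apply_smul_coord] at h
  rw [contrR_of_polyDeg_two (pd_mem_polyDeg hH hdeg i), ← pairOne_apply, map_neg, contrL_comm,
    neg_neg, h]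
  simp [← pairOne_apply]

/-- The vector `w` with `(∂̄ + [∂, ι_H]) (g vol) = w · vol`. -/
noncomputable def divVector (H : (Fin n → ℂ) → Ext n) (g : (Fin n → ℂ) → ℂ) (y : Fin n → ℂ) :
    Ext n :=
  ∑ j, wirtBar j g y • genBar j +
    ∑ i, (wirt i g y • contrR (coord i) (H y) + g y • contrR (coord i) (pd i H y))

/-- Differentiating g² contributes the factor 2g to the anchor term; the equal trace and divergence
contribute the same factor to the zeroth order term. -/
theorem elw_sq {H : (Fin n → ℂ) → Ext n} {g : (Fin n → ℂ) → ℂ} {y : Fin n → ℂ}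
    (hH : DiffAt H y) (hg : DifferentiableAt ℝ g y) (hdeg : ∀ z, H z ∈ polyDeg n 2)
    (α : Module.Dual ℂ (Fib n)) :
    elw H (fun _ => α) (fun z => g z ^ 2) y = 2 * g y * pairOne α (divVector H g y) := by
  have e : fderiv ℝ (fun z => g z ^ 2) y = (2 * g y) • fderiv ℝ g y := by
    simp only [pow_two]
    rw [fderiv_fun_mul hg hg]
    ext v
    simp only [_root_.add_apply, _root_.smul_apply, smul_eq_mul]
    ring
  rw [elw, sum_bracketPair_frame hH hdeg, anchorDiv_const hH, anchor_eq H _ (hg.fun_pow 2)]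
  simp only [divVector, wirt_eq, wirtBar_eq, e, map_smul, map_add, map_sum, smul_eq_mul, mul_add,
    Finset.sum_add_distrib, Finset.mul_sum]
  simp only [← Finset.sum_add_distrib, add_assoc]
  exact Finset.sum_congr rfl fun _ _ => by ring

theorem divVector_mem {H : (Fin n → ℂ) → Ext n} {y : Fin n → ℂ} (hH : DiffAt H y)
    (hdeg : ∀ z, H z ∈ polyDeg n 2) (g : (Fin n → ℂ) → ℂ) :
    divVector H g y ∈ LinearMap.range (ExteriorAlgebra.ι ℂ : Fib n →ₗ[ℂ] Ext n) := by
  have h {K : Ext n} (hK : K ∈ polyDeg n 2) (i : Fin n) :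
      contrR (coord i) K ∈ LinearMap.range (ExteriorAlgebra.ι ℂ : Fib n →ₗ[ℂ] Ext n) := by
    rw [contrR_of_polyDeg_two hK]
    obtain ⟨a, ha⟩ := contrL_of_polyDeg_two hK (coord i)
    exact neg_mem ⟨a, ha.symm⟩
  refine add_mem (sum_mem fun j _ => Submodule.smul_mem _ _ ⟨_, rfl⟩)
    (sum_mem fun i _ => add_mem (Submodule.smul_mem _ _ (h (hdeg y) i))
      (Submodule.smul_mem _ _ (h (pd_mem_polyDeg hH hdeg i) i)))

/-- Since dz_i ∧ vol = 0, moving dz_i past the action of ∂_iH leaves only the contraction of ∂_iH.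
-/
theorem kbOp_holVol {H : (Fin n → ℂ) → Ext n} {g : (Fin n → ℂ) → ℂ} {y : Fin n → ℂ}
    (hH : DiffAt H y) (hg : DifferentiableAt ℝ g y) (hdeg : ∀ z, H z ∈ polyDeg n 2) :
    kbOp H (fun z => g z • holVol n) y = clifford (divVector H g y) (holVol n) := by
  rw [kbOp_eq hH (DiffAt.smul_const hg _) hdeg]
  have h (i : Fin n) : gen i * clifford (pd i H y) (holVol n) =
      -clifford (contrR (coord i) (pd i H y)) (holVol n) := by
    rw [gen_mul_clifford, gen_mul_holVol, map_zero, zero_add,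
      contrR_of_polyDeg_two (pd_mem_polyDeg hH hdeg i), map_neg, LinearMap.neg_apply, neg_neg]
  have h' (i : Fin n) : contrL (coord i) (H y) = -contrR (coord i) (H y) := by
    rw [contrR_of_polyDeg_two (hdeg y), neg_neg]
  have hpd (i : Fin n) : pd i (fun z => g z • holVol n) y = wirt i g y • holVol n := by
    rw [pd_eq, pdWith_smul_const _ hg, ← wirt_eq]
  simp only [dbar, hpd, pdBar_eq, pdWith_smul_const _ hg, ← wirtBar_eq,
    map_smul, mul_smul_comm, h, h', divVector, map_add, map_sum, LinearMap.add_apply,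
    LinearMap.sum_apply, LinearMap.smul_apply, clifford_genBar, map_neg, LinearMap.neg_apply]
  rw [sub_eq_add_neg, ← Finset.sum_neg_distrib]
  congr 1
  exact Finset.sum_congr rfl fun i _ => by
    rw [neg_add, smul_neg, neg_neg, smul_neg, neg_neg, add_comm]

theorem kbOp_holVol_eq_zero {H : (Fin n → ℂ) → Ext n} {g : (Fin n → ℂ) → ℂ} {y : Fin n → ℂ}
    (hH : DiffAt H y) (hg : DifferentiableAt ℝ g y) (hdeg : ∀ z, H z ∈ polyDeg n 2)
    (hgy : g y ≠ 0)
    (hflat : ∀ α : Module.Dual ℂ (Fib n), elw H (fun _ => α) (fun z => g z ^ 2) y = 0) :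
    kbOp H (fun z => g z • holVol n) y = 0 := by
  rw [kbOp_holVol hH hg hdeg]
  obtain ⟨a, ha⟩ := divVector_mem hH hdeg g
  -- `divVector` has degree one, so its pairings with all covectors determine it; the factor 2g is
  -- cancelled.
  have ha0 : a = 0 := by
    refine (Module.forall_dual_apply_eq_zero_iff ℂ a).1 fun α => ?_
    have := hflat α
    rw [elw_sq hH hg hdeg, ← ha, pairOne_ι] at this
    simpa [hgy] using this
  rw [← ha, ha0, map_zero, map_zero, LinearMap.zero_apply]

end Flatness

/-! ### Degrees as weights -/

section Degrees

variable {n : ℕ}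

/-- Modular law: E k lies below W k ⊔ ⨆_{j ≠ k} E j, and intersecting with E k removes the second
term. Thus spanning subspaces of eigenspaces fill them. -/
theorem eq_of_iSupIndep_of_le {κ α : Type*} [CompleteLattice α] [IsModularLattice α]
    {E W : κ → α} (hE : iSupIndep E) (hW : ∀ k, W k ≤ E k) (htop : ⨆ k, W k = ⊤) (k : κ) :
    W k = E k := by
  have h : E k ≤ W k ⊔ ⨆ (j) (_ : j ≠ k), E j := by
    refine le_top.trans (htop.symm.le.trans (iSup_le fun j => ?_))
    rcases eq_or_ne j k with rfl | hj
    · exact le_sup_left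
    · exact (hW j).trans (le_sup_of_le_right (le_iSup₂_of_le j hj le_rfl))
  refine le_antisymm (hW k) (Eq.le ?_)
  calc E k = (W k ⊔ ⨆ (j) (_ : j ≠ k), E j) ⊓ E k := (inf_eq_right.2 h).symm
    _ = W k ⊔ (⨆ (j) (_ : j ≠ k), E j) ⊓ E k := sup_inf_assoc_of_le _ (hW k)
    _ = W k := by rw [inf_comm, (hE k).eq_bot, sup_bot_eq]

theorem eq_eigenspace {W : ℤ → Submodule ℂ (Ext n)} {T : Module.End ℂ (Ext n)} {t : ℂ}
    (ht : Function.Injective fun m : ℤ => t ^ m) (hW : ∀ m, W m ≤ T.eigenspace (t ^ m))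
    (htop : ⨆ m, W m = ⊤) (m : ℤ) : W m = T.eigenspace (t ^ m) :=
  eq_of_iSupIndep_of_le ((Module.End.eigenspaces_iSupIndep T).comp ht) hW htop m

theorem two_zpow_injective : Function.Injective fun m : ℤ => (2 : ℂ) ^ m := by
  intro a b h
  have h' : (2 : ℝ) ^ a = (2 : ℝ) ^ b := by
    have := congrArg norm h
    simpa using this
  exact zpow_right_injective₀ (by norm_num) (by norm_num) h'

theorem half_zpow_injective : Function.Injective fun m : ℤ => (2⁻¹ : ℂ) ^ m := by
  intro a b h
  simp only [inv_zpow'] at h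
  exact neg_injective (two_zpow_injective h)

variable (n) in
/-- Scaling of the two summands of the fibre. -/
noncomputable def scale (a b : ℂ) : Fib n →ₗ[ℂ] Fib n :=
  (a • LinearMap.id).prodMap (b • LinearMap.id)

theorem map_scale_gen (a b : ℂ) (i : Fin n) :
    ExteriorAlgebra.map (scale n a b) (gen i) = a • gen i := by
  rw [gen, ExteriorAlgebra.map_apply_ι, ← map_smul]
  simp [scale]

theorem map_scale_genBar (a b : ℂ) (j : Fin n) :
    ExteriorAlgebra.map (scale n a b) (genBar j) = b • genBar j := by
  rw [genBar, ExteriorAlgebra.map_apply_ι, ← map_smul]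
  simp [scale]

theorem map_of_mem_pow (f : Ext n →ₐ[ℂ] Ext n) {V : Submodule ℂ (Ext n)} {c : ℂ}
    (hV : ∀ x ∈ V, f x = c • x) {k : ℕ} {x : Ext n} (hx : x ∈ V ^ k) : f x = c ^ k • x := by
  induction hx using Submodule.pow_induction_on_left' with
  | algebraMap r => simp
  | add x y i _ _ h₁ h₂ => rw [map_add, h₁, h₂, smul_add]
  | mem_mul m hm i x _ h => rw [map_mul, hV m hm, h, smul_mul_smul_comm, pow_succ']

theorem map_of_mem_span (f : Ext n →ₐ[ℂ] Ext n) {κ : Type*} {v : κ → Ext n} {c : ℂ}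
    (hv : ∀ k, f (v k) = c • v k) {x : Ext n} (hx : x ∈ Submodule.span ℂ (Set.range v)) :
    f x = c • x := by
  induction hx using Submodule.span_induction with
  | mem x hx => obtain ⟨k, rfl⟩ := hx; exact hv k
  | zero => simp
  | add x y _ _ h₁ h₂ => rw [map_add, h₁, h₂, smul_add]
  | smul a x _ h => rw [map_smul, h, smul_comm]

theorem map_scale_of_formType {a b : ℂ} {i j : ℕ} {l : Ext n} (hl : l ∈ formType n i j) :
    ExteriorAlgebra.map (scale n a b) l = (a ^ i * b ^ j) • l := by
  induction hl using Submodule.mul_induction_on' with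
  | mem_mul_mem x hx y hy =>
    rw [map_mul, map_of_mem_pow _ (fun _ => map_of_mem_span _ (map_scale_gen a b)) hx,
      map_of_mem_pow _ (fun _ => map_of_mem_span _ (map_scale_genBar a b)) hy,
      smul_mul_smul_comm]
  | add x _ y _ h₁ h₂ => rw [map_add, h₁, h₂, smul_add]

theorem gen_mul_mem {i j : ℕ} {l : Ext n} (hl : l ∈ formType n i j) (k : Fin n) :
    gen k * l ∈ formType n (i + 1) j := by
  rw [formType, pow_succ', mul_assoc]
  exact Submodule.mul_mem_mul (Submodule.subset_span ⟨k, rfl⟩) hl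

theorem genBar_mul_mem {i j : ℕ} {l : Ext n} (hl : l ∈ formType n i j) (k : Fin n) :
    genBar k * l ∈ formType n i (j + 1) := by
  induction hl using Submodule.mul_induction_on' with
  | mem_mul_mem x hx y hy =>
    have hg (m : Fin n) : gradeInv (gen m) = (-1 : ℂ) • gen m := by
      rw [gen, gradeInv_ι, neg_one_smul]
    rw [← mul_assoc, genBar, ι_mul, map_of_mem_pow _ (fun _ => map_of_mem_span _ hg) hx,
      smul_mul_assoc, smul_mul_assoc, mul_assoc]
    refine Submodule.smul_mem _ _ (Submodule.mul_mem_mul hx ?_)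
    rw [pow_succ']
    exact Submodule.mul_mem_mul (Submodule.subset_span ⟨k, rfl⟩) hy
  | add x _ y _ h₁ h₂ => rw [mul_add]; exact add_mem h₁ h₂

theorem formType_le_formDeg (i j : ℕ) : formType n i j ≤ formDeg n (i - j) :=
  le_iSup_of_le i (le_iSup₂_of_le j rfl le_rfl)

/-- The span of all types contains the scalars and is stable under left multiplication by each
generator. -/
theorem iSup_formDeg : ⨆ m, formDeg n m = ⊤ := by
  have h : ⨆ m, formDeg n m = ⨆ (i : ℕ) (j : ℕ), formType n i j := by
    refine le_antisymm (iSup_le fun m => iSup_le fun i => iSup₂_le fun j _ => ?_)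
      (iSup₂_le fun i j => (formType_le_formDeg i j).trans (le_iSup _ _))
    exact le_iSup₂_of_le i j le_rfl
  rw [h, eq_top_iff]
  rintro l -
  induction l using ext_induction with
  | scalar r =>
    refine (le_iSup₂_of_le 0 0 le_rfl : formType n 0 0 ≤ _) ?_
    rw [formType, pow_zero, pow_zero, one_mul]
    exact Submodule.algebraMap_mem r
  | add x y hx hy => exact add_mem hx hy
  | ι_mul x a hx =>
    rw [fib_eq_sum, add_mul, Finset.sum_mul, Finset.sum_mul]
    have key {b : Ext n} (hb : ∀ i j, ∀ y ∈ formType n i j,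
        b * y ∈ ⨆ (i : ℕ) (j : ℕ), formType n i j) :
        b * x ∈ ⨆ (i : ℕ) (j : ℕ), formType n i j := by
      have : (⨆ (i : ℕ) (j : ℕ), formType n i j) ≤
          (⨆ (i : ℕ) (j : ℕ), formType n i j).comap (LinearMap.mulLeft ℂ b) :=
        iSup₂_le hb
      exact this hx
    refine add_mem (sum_mem fun i _ => ?_) (sum_mem fun j _ => ?_)
    · rw [smul_mul_assoc]
      exact Submodule.smul_mem _ _ (key fun p q y hy =>
        (le_iSup₂_of_le (p + 1) q le_rfl : formType n (p + 1) q ≤ _) (gen_mul_mem hy i))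
    · rw [smul_mul_assoc]
      exact Submodule.smul_mem _ _ (key fun p q y hy =>
        (le_iSup₂_of_le p (q + 1) le_rfl : formType n p (q + 1) ≤ _) (genBar_mul_mem hy j))

/-- Scaling dz by 2 and dz̄ by 1/2 multiplies type (i, j) by 2^{i-j}, and distinct integers give
distinct powers of 2. Membership becomes an eigenvalue equation, which transports in both
directions. -/
theorem mem_formDeg_iff {m : ℤ} {l : Ext n} :
    l ∈ formDeg n m ↔ ExteriorAlgebra.map (scale n 2 2⁻¹) l = (2 : ℂ) ^ m • l := by
  rw [eq_eigenspace (W := formDeg n) (T := (ExteriorAlgebra.map (scale n 2 2⁻¹)).toLinearMap)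
    two_zpow_injective ?_ iSup_formDeg m, Module.End.mem_eigenspace_iff]
  · rfl
  · refine fun m => iSup_le fun i => iSup₂_le fun j hm l hl => ?_
    rw [Module.End.mem_eigenspace_iff, AlgHom.toLinearMap_apply, map_scale_of_formType hl, ← hm,
      zpow_sub₀ two_ne_zero, zpow_natCast, zpow_natCast, inv_pow, div_eq_mul_inv]

theorem iSup_polyDeg : ⨆ m, polyDeg n m = ⊤ := by
  rw [eq_top_iff, ← (DirectSum.Decomposition.isInternal
    (fun i : ℕ => ⋀[ℂ]^i (Fib n))).submodule_iSup_eq_top]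
  exact iSup_le fun i => (polyDeg_natCast (n := n) i).symm.le.trans (le_iSup _ _)

theorem mem_polyDeg_iff {m : ℤ} {u : Ext n} :
    u ∈ polyDeg n m ↔ ExteriorAlgebra.map (scale n 2⁻¹ 2⁻¹) u = (2⁻¹ : ℂ) ^ m • u := by
  rw [eq_eigenspace (W := polyDeg n) (T := (ExteriorAlgebra.map (scale n 2⁻¹ 2⁻¹)).toLinearMap)
    half_zpow_injective ?_ iSup_polyDeg m, Module.End.mem_eigenspace_iff]
  · rfl
  · refine fun m => iSup₂_le fun j hm u hu => ?_
    rw [Module.End.mem_eigenspace_iff, AlgHom.toLinearMap_apply, ← hm, zpow_natCast]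
    refine map_of_mem_pow _ ?_ hu
    rintro _ ⟨a, rfl⟩
    rw [ExteriorAlgebra.map_apply_ι, ← map_smul]
    rfl

theorem holVol_mem : holVol n ∈ formType n n 0 := by
  rw [formType, pow_zero, mul_one, holVol, ExteriorAlgebra.ιMulti_apply]
  have h (L : List (Fin n)) :
      (L.map gen).prod ∈ Submodule.span ℂ (Set.range (gen : Fin n → Ext n)) ^ L.length := by
    induction L with
    | nil => simp [Submodule.one_le.1 le_rfl]
    | cons i L ih =>
      rw [List.map_cons, List.prod_cons, List.length_cons, pow_succ']
      exact Submodule.mul_mem_mul (Submodule.subset_span ⟨i, rfl⟩) ih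
  have := h (List.finRange n)
  rw [List.length_finRange] at this
  rw [List.ofFn_eq_map]
  exact this

/-- The scalings (1/2, 1/2) on A and (2, 1/2) on forms preserve the pairing of ∂/∂z_i with dz_i and
agree on dz̄_j, so the Clifford action is equivariant. As vol has weight 2^n, weight 2^{-k} goes to
2^{n-k}. -/
theorem volEquiv_mem_formDeg_iff {k : ℤ} {u : Ext n} :
    volEquiv n u ∈ formDeg n (n - k) ↔ u ∈ polyDeg n k := by
  have hvol : ExteriorAlgebra.map (scale n 2 2⁻¹) (holVol n) = (2 : ℂ) ^ n • holVol n := by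
    rw [map_scale_of_formType holVol_mem, pow_zero, mul_one]
  have e : ExteriorAlgebra.map (scale n 2 2⁻¹) (volEquiv n u) =
      (2 : ℂ) ^ n • volEquiv n (ExteriorAlgebra.map (scale n 2⁻¹ 2⁻¹) u) := by
    rw [volEquiv_apply, volEquiv_apply,
      ← clifford_map (A := scale n 2⁻¹ 2⁻¹) (B := scale n 2 2⁻¹), hvol, map_smul]
    · intro a b
      simp only [vecPair_apply, scale, LinearMap.prodMap_apply, LinearMap.smul_apply,
        LinearMap.id_apply, Pi.smul_apply, smul_eq_mul]
      exact Finset.sum_congr rfl fun i _ => by ring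
    · intro a
      simp [scale]
  rw [mem_formDeg_iff, mem_polyDeg_iff, e, zpow_sub₀ two_ne_zero, zpow_natCast, div_eq_mul_inv,
    ← inv_zpow, mul_smul, ← map_smul (volEquiv n) ((2⁻¹ : ℂ) ^ k)]
  rw [(smul_right_injective (Ext n) (pow_ne_zero n (two_ne_zero (α := ℂ)))).eq_iff,
    (volEquiv n).injective.eq_iff]

theorem map_mem_polyDeg (A : Fib n →ₗ[ℂ] Fib n) {k : ℤ} {u : Ext n} (hu : u ∈ polyDeg n k) :
    ExteriorAlgebra.map A u ∈ polyDeg n k := by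
  rw [mem_polyDeg_iff] at hu ⊢
  have h : scale n 2⁻¹ 2⁻¹ ∘ₗ A = A ∘ₗ scale n 2⁻¹ 2⁻¹ := by
    have e : scale n 2⁻¹ 2⁻¹ = (2⁻¹ : ℂ) • LinearMap.id := rfl
    rw [e, LinearMap.smul_comp, LinearMap.comp_smul, LinearMap.id_comp, LinearMap.comp_id]
  rw [← AlgHom.comp_apply, ExteriorAlgebra.map_comp_map, h, ← ExteriorAlgebra.map_comp_map,
    AlgHom.comp_apply, hu, map_smul]

end Degrees

/-! ### Sections over the manifold -/

section Global

theorem kbOp_congr {n : ℕ} (H : (Fin n → ℂ) → Ext n) {l l' : (Fin n → ℂ) → Ext n}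
    {y : Fin n → ℂ} (h : l =ᶠ[𝓝 y] l') : kbOp H l y = kbOp H l' y := by
  have h' : (fun z => interior (H z) (l z)) =ᶠ[𝓝 y] fun z => interior (H z) (l' z) :=
    h.mono fun z hz => by simp only [hz]
  simp only [kbOp, dbar, del, pd_eq, pdBar_eq, pdWith_congr _ h, pdWith_congr _ h']

theorem contDiffOn_functional {n : ℕ} {u : (Fin n → ℂ) → Ext n} {t : Set (Fin n → ℂ)}
    (hu : ∀ S, ContDiffOn ℝ ∞ (coeff S u) t) (φ : Ext n →ₗ[ℂ] ℂ) :
    ContDiffOn ℝ ∞ (fun z => φ (u z)) t := by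
  rw [functional_eq_sum]
  exact ContDiffOn.sum fun S _ => (hu S).mul contDiffOn_const

variable (n : ℕ) in
/-- The coefficient of a multiple of `dz_1 ∧ ⋯ ∧ dz_n`. -/
noncomputable def volCoeff : Ext n →ₗ[ℂ] ℂ :=
  (ExteriorAlgebra.algebraMapInv (R := ℂ) (M := Fib n)).toLinearMap ∘ₗ
    (volEquiv n).symm.toLinearMap

theorem volCoeff_smul_holVol {n : ℕ} (c : ℂ) : volCoeff n (c • holVol n) = c := by
  have h : c • holVol n = volEquiv n (algebraMap ℂ (Ext n) c) := by
    rw [volEquiv_apply, AlgHom.commutes, Module.algebraMap_end_apply]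
  rw [volCoeff, h, LinearMap.comp_apply, LinearEquiv.coe_coe, LinearEquiv.symm_apply_apply]
  exact ExteriorAlgebra.algebraMap_leftInverse (Fib n) c

/-- Pointwise Clifford action on a nowhere vanishing section of the canonical bundle. -/
theorem exists_equiv_clifford {n : ℕ} {X : Type*} {s : X → Ext n} {h : X → ℂ}
    (hs : ∀ x, s x = h x • holVol n)
    (h0 : ∀ x, s x ≠ 0) :
    ∃ Ψ : (X → Ext n) ≃ₗ[ℂ] (X → Ext n), ∀ u, Ψ u = fun x => clifford (u x) (s x) := by
  have hh (x : X) : h x ≠ 0 := fun hx => h0 x (by rw [hs, hx, zero_smul])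
  refine ⟨LinearEquiv.piCongrRight fun x =>
    (volEquiv n).trans (LinearEquiv.smulOfNeZero ℂ (Ext n) (h x) (hh x)), fun u => ?_⟩
  funext x
  rw [hs, map_smul]
  rfl

variable {n : ℕ} {X : Type*} [TopologicalSpace X] [ChartedSpace (Fin n → ℂ) X]
  [IsManifold 𝓘(ℂ, Fin n → ℂ) ω X]

/-! ### Changes of chart and the global Clifford action -/

theorem jac_self (x : X) : jac x x x = (1 : Matrix (Fin n) (Fin n) ℂ) := by
  rw [← LinearMap.toMatrix'_id]
  refine congrArg _ (LinearMap.ext fun v => ?_)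
  exact tangentCoordChange_self (by simp)

theorem jac_mul_jac {p q x : X} (hp : x ∈ (chartAt (Fin n → ℂ) p).source)
    (hq : x ∈ (chartAt (Fin n → ℂ) q).source) :
    jac q p x * jac p q x = (1 : Matrix (Fin n) (Fin n) ℂ) := by
  rw [jac, jac, ← LinearMap.toMatrix'_comp, ← LinearMap.toMatrix'_id]
  refine congrArg _ (LinearMap.ext fun v => ?_)
  have hp' : x ∈ (extChartAt 𝓘(ℂ, Fin n → ℂ) p).source := by rwa [extChartAt_source]
  have hq' : x ∈ (extChartAt 𝓘(ℂ, Fin n → ℂ) q).source := by rwa [extChartAt_source]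
  exact (tangentCoordChange_comp ⟨⟨hp', hq'⟩, hp'⟩).trans (tangentCoordChange_self hp')

theorem formChange_self (x : X) : formChange x x = (LinearMap.id : Fib n →ₗ[ℂ] Fib n) := by
  refine LinearMap.ext fun a => ?_
  rw [formChange, jac_self, Matrix.map_one _ (star_zero _) (star_one _)]
  simp

theorem formLoc_self (u : X → Ext n) (x : X) : formLoc x u (chartAt (Fin n → ℂ) x x) = u x := by
  simp [formLoc, formChange_self]

/-- Vectors change by a Jacobian and the dz_i by the transpose of its inverse, so their pairing is
preserved; dz̄_j changes identically in both bundles. Hence `clifford_map` applies. -/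
theorem formLoc_clifford (s u : X → Ext n) (p : X) {y : Fin n → ℂ}
    (hy : y ∈ (chartAt (Fin n → ℂ) p).target) :
    formLoc p (fun x => clifford (u x) (s x)) y = clifford (polyLoc p u y) (formLoc p s y) := by
  have hx := (chartAt (Fin n → ℂ) p).map_target hy
  set x := (chartAt (Fin n → ℂ) p).symm y with hxy
  refine (clifford_map (fun a b => ?_) (fun a => ?_) _ _).symm
  · have h : jac p x x * jac x p x = 1 := jac_mul_jac (mem_chart_source _ x) hx
    have e (v w : Fin n → ℂ) (z : Fin n → ℂ) : vecPair v ((w, z) : Fib n) = w ⬝ᵥ v := by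
      rw [vecPair_apply, dotProduct_comm]; rfl
    simp only [polyChange, formChange, LinearMap.prodMap_apply, e]
    rw [Matrix.vecMulLinear_apply, Matrix.mulVecLin_apply, ← Matrix.dotProduct_mulVec,
      Matrix.mulVec_mulVec, h, Matrix.one_mulVec, ← e _ _ b.2]
  · simp [polyChange, formChange]

theorem map_formChange_injective {p x : X} (hx : x ∈ (chartAt (Fin n → ℂ) p).source) :
    Function.Injective (ExteriorAlgebra.map (formChange p x : Fib n →ₗ[ℂ] Fib n)) := by
  have h : jac p x x * jac x p x = (1 : Matrix (Fin n) (Fin n) ℂ) :=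
    jac_mul_jac (mem_chart_source _ x) hx
  refine ExteriorAlgebra.map_injective (f := (formChange p x : Fib n →ₗ[ℂ] Fib n))
    ⟨(jac x p x).vecMulLinear.prodMap ((jac x p x).map star).vecMulLinear,
      LinearMap.ext fun a => ?_⟩
  have h' : (jac p x x).map (starRingEnd ℂ) * (jac x p x).map (starRingEnd ℂ) =
      (1 : Matrix (Fin n) (Fin n) ℂ) := by
    rw [← Matrix.map_mul, h]
    simp
  refine Prod.ext ?_ ?_
  · simp [formChange, h]
  · simp [formChange, h']

theorem formLoc_ne_zero {s : X → Ext n} (h0 : ∀ x, s x ≠ 0) (p : X) {y : Fin n → ℂ}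
    (hy : y ∈ (chartAt (Fin n → ℂ) p).target) : formLoc p s y ≠ 0 := fun h =>
  h0 _ ((map_eq_zero_iff _ (map_formChange_injective
    ((chartAt (Fin n → ℂ) p).map_target hy))).1 h)

/-- In each chart the map is g times the constant isomorphism `volEquiv`, with g smooth and nowhere
zero, so smoothness passes both ways. -/
theorem clifford_mem_formSections_iff {s : X → Ext n} {g : X → (Fin n → ℂ) → ℂ}
    (hsm : s ∈ FormSections n X) (h0 : ∀ x, s x ≠ 0)
    (hg : ∀ p, ∀ y ∈ (chartAt (Fin n → ℂ) p).target, formLoc p s y = g p y • holVol n)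
    {u : X → Ext n} :
    (fun x => clifford (u x) (s x)) ∈ FormSections n X ↔ u ∈ PolySections n X := by
  have hg0 (p : X) : ∀ y ∈ (chartAt (Fin n → ℂ) p).target, g p y ≠ 0 := fun y hy h =>
    formLoc_ne_zero h0 p hy (by rw [hg p y hy, h, zero_smul])
  have hgs (p : X) : ContDiffOn ℝ ∞ (g p) (chartAt (Fin n → ℂ) p).target :=
    (contDiffOn_functional (hsm p) (volCoeff n)).congr fun y hy => by
      rw [hg p y hy, volCoeff_smul_holVol]
  have key (p : X) : ∀ y ∈ (chartAt (Fin n → ℂ) p).target,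
      formLoc p (fun x => clifford (u x) (s x)) y = g p y • volEquiv n (polyLoc p u y) := by
    intro y hy
    rw [formLoc_clifford s u p hy, hg p y hy, map_smul, volEquiv_apply]
  refine ⟨fun h p S => ?_, fun h p S => ?_⟩
  · refine (((hgs p).inv (hg0 p)).mul (contDiffOn_functional (h p)
      ((extFrame n).coord S ∘ₗ (volEquiv n).symm.toLinearMap))).congr fun y hy => ?_
    simp [key p y hy, coeff, inv_mul_cancel_left₀ (hg0 p y hy)]
  · refine ((hgs p).mul (contDiffOn_functional (h p)
      ((extFrame n).coord S ∘ₗ (volEquiv n).toLinearMap))).congr fun y hy => ?_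
    simp [key p y hy, coeff]

theorem kbOp_clifford_section (H : ExtendedPoisson n X) {s : X → Ext n}
    {g : X → (Fin n → ℂ) → ℂ} (hsm : s ∈ FormSections n X) (h0 : ∀ x, s x ≠ 0)
    (hg : ∀ p, ∀ y ∈ (chartAt (Fin n → ℂ) p).target, formLoc p s y = g p y • holVol n)
    (hflat : ∀ (x : X) (α : Module.Dual ℂ (Fib n)),
      elw (polyLoc x H.sec) (fun _ => α) (fun y => g x y ^ 2) (chartAt (Fin n → ℂ) x x) = 0)
    {u : X → Ext n} (hu : u ∈ PolySections n X) (x : X) :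
    kbOp (polyLoc x H.sec) (formLoc x fun x => clifford (u x) (s x)) (chartAt (Fin n → ℂ) x x) =
      clifford (dbarTwist (polyLoc x H.sec) (polyLoc x u) (chartAt (Fin n → ℂ) x x)) (s x) := by
  have hmem := mem_chart_target (Fin n → ℂ) x
  have hnhds := (chartAt (Fin n → ℂ) x).open_target.mem_nhds hmem
  have hgx : DifferentiableAt ℝ (g x) (chartAt (Fin n → ℂ) x x) := by
    refine ((FormSections.diffAt hsm x).functional (volCoeff n)).congr_of_eventuallyEq ?_
    filter_upwards [hnhds] with y hy
    rw [hg x y hy, volCoeff_smul_holVol]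
  have hgx0 : g x (chartAt (Fin n → ℂ) x x) ≠ 0 := fun h =>
    formLoc_ne_zero h0 x hmem (by rw [hg x _ hmem, h, zero_smul])
  -- This holds also off the chart's target, since any linear map of fibres preserves exterior
  -- degree.
  have hdeg : ∀ z, polyLoc x H.sec z ∈ polyDeg n 2 := fun z => map_mem_polyDeg _ (H.degree _)
  have hH := PolySections.diffAt H.smooth x
  -- The chart expression of u · s is a Clifford product only on the target, so it is replaced near
  -- the centre; there the derivation rule applies, and its last term vanishes by flatness.
  rw [kbOp_congr (l' := fun z => clifford (polyLoc x u z) (g x z • holVol n)),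
    kbOp_clifford hH (PolySections.diffAt hu x) (DiffAt.smul_const hgx _) hdeg,
    kbOp_holVol_eq_zero hH hgx hdeg hgx0 (hflat x), map_zero, add_zero, ← hg x _ hmem,
    formLoc_self]
  filter_upwards [hnhds] with y hy
  rw [formLoc_clifford s u x hy, hg x y hy]

/-! ### Passage to homology -/

theorem mem_poissonZ {H : ExtendedPoisson n X} {k : ℤ} {u : X → Ext n} :
    u ∈ poissonZ H k ↔ ∃ hu : u ∈ PolySections n X, (∀ x, u x ∈ polyDeg n k) ∧
      poissonD H ⟨u, hu⟩ = 0 :=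
  ⟨fun ⟨v, hv, h⟩ => h ▸ ⟨v.2, hv.1, hv.2⟩, fun ⟨hu, h₁, h₂⟩ => ⟨⟨u, hu⟩, ⟨h₁, h₂⟩, rfl⟩⟩

theorem mem_kbZ {H : ExtendedPoisson n X} {k : ℤ} {w : X → Ext n} :
    w ∈ kbZ H k ↔ ∃ hw : w ∈ FormSections n X, (∀ x, w x ∈ formDeg n (k - n)) ∧
      kbD H ⟨w, hw⟩ = 0 :=
  ⟨fun ⟨v, hv, h⟩ => h ▸ ⟨v.2, hv.1, hv.2⟩, fun ⟨hw, h₁, h₂⟩ => ⟨⟨w, hw⟩, ⟨h₁, h₂⟩, rfl⟩⟩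

/-- The Clifford action on the flat section is an isomorphism between cochains and chains that
intertwines the differentials. -/
theorem ExtendedPoisson.IsUnimodular.exists_equiv {H : ExtendedPoisson n X}
    (hH : H.IsUnimodular) :
    ∃ Ψ : (X → Ext n) ≃ₗ[ℂ] (X → Ext n),
      (∀ u, Ψ u ∈ FormSections n X ↔ u ∈ PolySections n X) ∧
      (∀ (k : ℤ) u x, Ψ u x ∈ formDeg n (n - k) ↔ u x ∈ polyDeg n k) ∧
      ∀ u (hu : u ∈ PolySections n X) (hw : Ψ u ∈ FormSections n X),
        kbD H ⟨Ψ u, hw⟩ = Ψ (poissonD H ⟨u, hu⟩) := by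
  obtain ⟨s, hsm, -, h0, h⟩ := hH
  choose g hg hflat using h
  have hs (x : X) : s x = g x (chartAt (Fin n → ℂ) x x) • holVol n := by
    rw [← hg x _ (mem_chart_target _ x), formLoc_self]
  obtain ⟨Ψ, hΨ⟩ := exists_equiv_clifford hs h0
  refine ⟨Ψ, fun u => ?_, fun k u x => ?_, fun u hu hw => ?_⟩
  · rw [hΨ, clifford_mem_formSections_iff hsm h0 hg]
  · have hgx : g x (chartAt (Fin n → ℂ) x x) ≠ 0 := fun hx => h0 x (by rw [hs, hx, zero_smul])
    simp only [hΨ]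
    rw [hs, map_smul, Submodule.smul_mem_iff _ hgx, ← volEquiv_apply,
      volEquiv_mem_formDeg_iff]
  · funext x
    have e := kbOp_clifford_section H hsm h0 hg hflat hu x
    rw [← hΨ] at e
    rw [hΨ (poissonD H ⟨u, hu⟩)]
    exact e

/-- Pairs of submodules matched by a linear equivalence have isomorphic quotients. -/
theorem nonempty_quotient_equiv {V W : Type*} [AddCommGroup V] [Module ℂ V] [AddCommGroup W]
    [Module ℂ W] (Ψ : V ≃ₗ[ℂ] W) {Z B : Submodule ℂ V} {Z' B' : Submodule ℂ W}
    (hZ : ∀ v, Ψ v ∈ Z' ↔ v ∈ Z) (hB : ∀ v, Ψ v ∈ B' ↔ v ∈ B) :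
    Nonempty ((Z' ⧸ B'.submoduleOf Z') ≃ₗ[ℂ] Z ⧸ B.submoduleOf Z) := by
  have hmap : Z.map (Ψ : V →ₗ[ℂ] W) = Z' := by
    ext w
    obtain ⟨v, rfl⟩ := Ψ.surjective w
    rw [hZ]
    exact (Submodule.mem_map_equiv Z).trans (by rw [Ψ.symm_apply_apply])
  -- `submoduleOf` restricts `B` to `Z`, so the quotients make sense and correspond without an
  -- inclusion of `B` in `Z`.
  refine ⟨(Submodule.Quotient.equiv (B.submoduleOf Z) (B'.submoduleOf Z')
    (Ψ.ofSubmodules Z Z' hmap) ?_).symm⟩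
  ext ⟨w, hw⟩
  obtain ⟨v, rfl⟩ := Ψ.surjective w
  refine (Submodule.mem_map_equiv _).trans ?_
  simp [Submodule.submoduleOf, hB]

end Global

end ExtPoisson

theorem mainTheorem9 {n : ℕ} {X : Type*} [TopologicalSpace X] [ChartedSpace (Fin n → ℂ) X]
    [IsManifold 𝓘(ℂ, Fin n → ℂ) ω X] (H : ExtPoisson.ExtendedPoisson n X)
    (hH : H.IsUnimodular) (k : ℤ) :
    Nonempty (ExtPoisson.KBHomology H k ≃ₗ[ℂ] ExtPoisson.PoissonCohomology H (2 * n - k)) := by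
  obtain ⟨Ψ, hsec, hdeg, hD⟩ := hH.exists_equiv
  refine ExtPoisson.nonempty_quotient_equiv Ψ (fun u => ?_) (fun v => ?_)
  · have hk : k - n = n - (2 * n - k) := by ring
    rw [ExtPoisson.mem_kbZ, ExtPoisson.mem_poissonZ, hk]
    refine ⟨fun ⟨hw, h₁, h₂⟩ => ?_, fun ⟨hu, h₁, h₂⟩ => ?_⟩
    · have hu := (hsec u).1 hw
      rw [hD u hu hw, map_eq_zero_iff _ Ψ.injective] at h₂
      exact ⟨hu, fun x => (hdeg _ u x).1 (h₁ x), h₂⟩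
    · have hw := (hsec u).2 hu
      exact ⟨hw, fun x => (hdeg _ u x).2 (h₁ x), by rw [hD u hu hw, h₂, map_zero]⟩
  -- Boundaries come from chains of degree k + 1, which correspond to cochains of degree 2n - k - 1.
  · have hk : k + 1 - n = n - (2 * n - k - 1) := by ring
    constructor
    · rintro ⟨⟨w, hw⟩, h₁, h₂⟩
      obtain ⟨u, rfl⟩ := Ψ.surjective w
      have hu := (hsec u).1 hw
      rw [hD u hu hw] at h₂
      refine ⟨⟨u, hu⟩, fun x => (hdeg _ u x).1 ?_, Ψ.injective h₂⟩
      rw [← hk]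
      exact h₁ x
    · rintro ⟨⟨u, hu⟩, h₁, rfl⟩
      have hw := (hsec u).2 hu
      refine ⟨⟨Ψ u, hw⟩, fun x => ?_, hD u hu hw⟩
      rw [hk]
      exact (hdeg _ u x).2 (h₁ x)
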